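/- **Setting.** Let $T\ge 1$ be an integer and let $W_T(s)$, $s\in G:=\{0,\tfrac1T,\tfrac2T,\dots,1\}$, be unitary operators on a complex Hilbert space; $\|\cdot\|$ is the operator (spectral) norm. The actual evolution is $U_T(0)=I$, $U_T(s+\tfrac1T)=W_T(s)\,U_T(s)$. For each $s\in G$ let the spectrum of $W_T(s)$ be the disjoint union of $\sigma_P(s)$ (the spectrum of interest) and $\sigma_Q(s)$, and let $P_T(s)$ be the spectral projection of $W_T(s)$ onto $\sigma_P(s)$, $Q_T(s)=I-P_T(s)$. The ideal adiabatic evolution is $$U_T^A(0)=I,\qquad U_T^A(s+\tfrac1T)=V_T(s)\,W_T(s)\,U_T^A(s),$$ where $V_T(s)=(S S^\dagger)^{-1/2}S$ with $S=P_T(s+\tfrac1T)P_T(s)+Q_T(s+\tfrac1T)Q_T(s)$. *Differences.* $DW_T(s)=W_T(s+\tfrac1T)-W_T(s)$ and $D^{(2)}W_T(s)=DW_T(s+\tfrac1T)-DW_T(s)$. Let $c_k(s)$ be real numbers with $\|D^{(k)}W_T(s)\|\le c_k(s)/T^k$ for $k=1,2$ and all $s\in G\cap[0,1-k/T]$, and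 put $$\hat c_k(s)=\max\{c_k(s'):\ s'\in\{s-\tfrac1T,s,s+\tfrac1T\}\cap[0,1-k/T]\}.$$ *Gaps.* For $k=0,1,2$ and $s\in G\cap[0,1-k/T]$ let $\sigma_P^{(k)}(s)\supseteq\bigcup_{l=0}^k\sigma_P(s+l/T)$ and $\sigma_Q^{(k)}(s)\supseteq\bigcup_{l=0}^k\sigma_Q(s+l/T)$ be disjoint closed arcs of the unit circle, and let $\Delta_k(s)$ be the minimum angular distance between them. Put $\Delta(s)=\Delta_2(s)$ for $0\le s\le 1-2/T$, $\Delta(1-1/T)=\Delta_1(1-1/T)$, $\Delta(1)=\Delta_0(1)$, and $$\check\Delta(s)=\min\{\Delta(s'):\ s'\in\{s-\tfrac1T,s,s+\tfrac1T\}\cap[0,1]\}.$$ **Theorem (The Second Discrete Adiabatic Theorem).** If $T\ge\max_{s\in G}4\hat c_1(s)/\check\Delta(s)$, then for every $s\in[0,1]$ with $sT\in\mathbb N$ $$\begin{aligned}\|U_T(s)-U_T^A(s)\|\le{}&\frac{12\,\hat c_1(0)}{T\check\Delta(0)^2}+\frac{12\,\hat c_1(s)}{T\check\Delta(s)^2}+\frac{6\,\hat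 c_1(s)}{T\check\Delta(s)}+305\sum_{n=1}^{sT-1}\frac{\hat c_1(n/T)^2}{T^2\check\Delta(n/T)^3}\\&+44\sum_{n=0}^{sT-1}\frac{\hat c_1(n/T)^2}{T^2\check\Delta(n/T)^2}+32\sum_{n=1}^{sT-1}\frac{\hat c_2(n/T)}{T^2\check\Delta(n/T)^2}.\end{aligned}$$ -/

import Mathlib

/-!
Throughout, `T` is the total number of steps and the discrete time `s = n / T` is represented by
its index `n`, so that `W n` stands for the walk operator `W_T(n / T)`, a shift of `s` by `1 / T` is
a shift of `n` by `1`, and `s ∈ [0, 1]` means `n ≤ T`.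
-/

noncomputable section

namespace DiscreteAdiabatic

/-! ### Spectral projections and the two evolutions -/

section Operators

variable {H : Type*} [NormedAddCommGroup H] [InnerProductSpace ℂ H] [CompleteSpace H]

/-- The spectral projection of the unitary (more generally, normal) operator `W` onto the part `σ`
of its spectrum: the functional calculus of the indicator function of `σ`.  It is meaningful when
`σ ∩ spectrum ℂ W` is open and closed in the spectrum, which holds whenever this part and the rest
of the spectrum lie in two disjoint closed arcs. -/
def spectralProj (W : H →L[ℂ] H) (σ : Set ℂ) : H →L[ℂ] H :=
  cfc (σ.indicator (fun _ => (1 : ℂ))) W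

/-- `S = P' P + Q' Q`, where `Q = 1 - P` and `Q' = 1 - P'`. -/
def transferS (P' P : H →L[ℂ] H) : H →L[ℂ] H :=
  P' * P + (1 - P') * (1 - P)

/-- `v = √(S S†)`. -/
def transferAbs (P' P : H →L[ℂ] H) : H →L[ℂ] H :=
  CFC.sqrt (transferS P' P * star (transferS P' P))

/-- `V = v⁻¹ S`, the unitary of the left polar decomposition of `S` (when `v` is invertible). -/
def transferV (P' P : H →L[ℂ] H) : H →L[ℂ] H :=
  Ring.inverse (transferAbs P' P) * transferS P' P

/-- The actual evolution: `U(0) = 1`, `U(n + 1) = W(n) U(n)`, that is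
`U(n) = W(n - 1) ⋯ W(1) W(0)`. -/
def evolution (W : ℕ → H →L[ℂ] H) : ℕ → H →L[ℂ] H
  | 0 => 1
  | n + 1 => W n * evolution W n

/-- The adiabatic walk operator `W^A(n) = V(n + 1, n) W(n)`, where `V(n + 1, n)` is built from the
spectral projections of `W (n + 1)` and `W n` onto the spectra of interest `σP (n + 1)`, `σP n`. -/
def adiabaticWalk (W : ℕ → H →L[ℂ] H) (σP : ℕ → Set ℂ) (n : ℕ) : H →L[ℂ] H :=
  transferV (spectralProj (W (n + 1)) (σP (n + 1))) (spectralProj (W n) (σP n)) * W n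

/-- The ideal adiabatic evolution: `U^A(0) = 1`, `U^A(n + 1) = W^A(n) U^A(n)`. -/
def adiabaticEvolution (W : ℕ → H →L[ℂ] H) (σP : ℕ → Set ℂ) : ℕ → H →L[ℂ] H :=
  evolution (adiabaticWalk W σP)

end Operators

/-! ### Multistep differences -/

/-- `ĉ_k(n)`: the maximum of `c k m` over the neighbours `m ∈ {n - 1, n, n + 1}` of `n` with
`0 ≤ m ≤ T - k`. -/
def cHat (T : ℕ) (c : ℕ → ℕ → ℝ) (k n : ℕ) : ℝ :=
  sSup (c k '' {m : ℕ | (m + 1 = n ∨ m = n ∨ m = n + 1) ∧ m + k ≤ T})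

/-! ### Arcs and multistep gaps -/

/-- A (nonempty, closed) arc of the unit circle of the complex plane. -/
def IsArc (A : Set ℂ) : Prop :=
  ∃ a b : ℝ, a ≤ b ∧ A = (fun θ : ℝ => Complex.exp (θ * Complex.I)) '' Set.Icc a b

/-- The minimum angular distance between two subsets of the unit circle; the angular distance of
two points is the unoriented angle in `[0, π]` between them. -/
def angularDist (A B : Set ℂ) : ℝ :=
  sInf (Set.image2 InnerProductGeometry.angle A B)

/-- `AP k n` and `AQ k n` are disjoint arcs that contain the spectra of interest, respectively the
complementary spectra, of the `k + 1` successive steps `n, n + 1, …, n + k`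
(for `k = 0, 1, 2`, as long as these steps do not go beyond the last one, `T`). -/
structure AreMultistepArcs (T : ℕ) (σP σQ : ℕ → Set ℂ) (AP AQ : ℕ → ℕ → Set ℂ) : Prop where
  isArc_left : ∀ k n, k ≤ 2 → n + k ≤ T → IsArc (AP k n)
  isArc_right : ∀ k n, k ≤ 2 → n + k ≤ T → IsArc (AQ k n)
  disjoint : ∀ k n, k ≤ 2 → n + k ≤ T → Disjoint (AP k n) (AQ k n)
  subset_left : ∀ k n, k ≤ 2 → n + k ≤ T → (⋃ l ∈ Set.Iic k, σP (n + l)) ⊆ AP k n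
  subset_right : ∀ k n, k ≤ 2 → n + k ≤ T → (⋃ l ∈ Set.Iic k, σQ (n + l)) ⊆ AQ k n

/-- `Δ_k(n)`: the minimum angular distance between the arcs for `k + 1` successive steps. -/
def gapK (AP AQ : ℕ → ℕ → Set ℂ) (k n : ℕ) : ℝ :=
  angularDist (AP k n) (AQ k n)

/-- `Δ(n)`: it is `Δ_2(n)` for `n ≤ T - 2`, `Δ_1(n)` for `n = T - 1`, and `Δ_0(n)` for `n = T`. -/
def gap (T : ℕ) (AP AQ : ℕ → ℕ → Set ℂ) (n : ℕ) : ℝ :=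
  if n + 2 ≤ T then gapK AP AQ 2 n
  else if n + 1 = T then gapK AP AQ 1 n
  else gapK AP AQ 0 n

/-- `Δ̌(n)`: the minimum of `Δ` over the neighbours `m ∈ {n - 1, n, n + 1}` of `n` with
`0 ≤ m ≤ T`. -/
def gapCheck (T : ℕ) (AP AQ : ℕ → ℕ → Set ℂ) (n : ℕ) : ℝ :=
  sInf (gap T AP AQ '' {m : ℕ | (m + 1 = n ∨ m = n ∨ m = n + 1) ∧ m ≤ T})

end DiscreteAdiabatic

end

/-! Write `U` and `Y` for the actual and the adiabatic evolutions. All factors are unitary, so the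
error is `‖Y†U - 1‖`, and one step changes `Y†U` by `Y†W†(V† - 1)W U`. This is of order `1/T`, so
adding up norms over `T` steps would give only `O(1)`.

The gain comes from the first-order part `O` of `V† - 1`, which can be chosen exactly off-diagonal
for `P`. Across a gap the commutator with `W` is invertible on off-diagonal operators, so `XW - WX =
OW` has an off-diagonal solution `X` of size `‖O‖/δ`. Then `W†OW = W†XW - X` is a discrete
derivative. Summation by parts (`norm_evolution_sub_boundary_le`) leaves two boundary values of `X`,
the increments `X (n + 1) - X n`, and the terms `V† - 1 - O` and `(V† - 1)X`. The interior terms are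
of second order, so their sum is `O(1/T)`.

The gap enters only through `SylvesterBound`, with `δ` half the angular distance. A circle centred
at the midpoint of the shorter arc separates the two spectral parts, with radii differing by at
least `δ`; a reduced resolvent and a Neumann series then bound and solve the block equations. The
same bound, applied to suitable operators, controls the first and second differences of the
projections (`norm_proj_sub_le`, `norm_proj_second_diff_le`) and of the correctors
(`IsCorrector.norm_step_le`). -/

noncomputable section

namespace DiscreteAdiabatic

/-! ### Block decomposition with respect to projections. -/

section Blocks

variable {A : Type*} [Ring A]

/-- The off-diagonal part of `X` with respect to the decompositions `1 = P₁ + (1 - P₁)` of the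
target and `1 = P₂ + (1 - P₂)` of the source. -/
def offDiag (P₁ P₂ X : A) : A :=
  P₁ * X * (1 - P₂) + (1 - P₁) * X * P₂

/-- The diagonal part of `X`, complementary to `offDiag`. -/
def onDiag (P₁ P₂ X : A) : A :=
  P₁ * X * P₂ + (1 - P₁) * X * (1 - P₂)

lemma offDiag_add_onDiag (P₁ P₂ X : A) : offDiag P₁ P₂ X + onDiag P₁ P₂ X = X := by
  unfold offDiag onDiag
  noncomm_ring

lemma offDiag_one_sub (P₁ P₂ X : A) : offDiag (1 - P₁) (1 - P₂) X = offDiag P₁ P₂ X := by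
  unfold offDiag
  rw [sub_sub_cancel, sub_sub_cancel, add_comm]

end Blocks

/-! ### Sylvester equations for spectra separated by a circle. -/

section Sylvester

variable {H : Type*} [NormedAddCommGroup H] [InnerProductSpace ℂ H] [CompleteSpace H]

lemma norm_sq_add_norm_sq_compl {P : H →L[ℂ] H} (hP : IsStarProjection P) (x y : H) :
    ‖P x + (1 - P) y‖ ^ 2 = ‖P x‖ ^ 2 + ‖(1 - P) y‖ ^ 2 := by
  have h0 : inner ℂ (P x) ((1 - P) y) = 0 := by
    have h1 : P = ContinuousLinearMap.adjoint P := hP.isSelfAdjoint.star_eq.symm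
    rw [h1, ContinuousLinearMap.adjoint_inner_left, ← h1]
    have h2 : P * (1 - P) = 0 := by
      rw [mul_sub, mul_one, hP.isIdempotentElem.eq, sub_self]
    have h3 : P ((1 - P) y) = (P * (1 - P)) y := rfl
    rw [h3, h2]; simp
  have := norm_add_sq_eq_norm_sq_add_norm_sq_of_inner_eq_zero (𝕜 := ℂ) (P x) ((1 - P) y) h0
  simpa [sq] using this

/-- The two blocks have orthogonal ranges and act on orthogonal components of the vector, so
Pythagoras on both sides gives the maximum of the norms, not their sum. This keeps the gap constant
free of a factor 2. -/
lemma norm_antidiagonal_le {P₁ P₂ A B : H →L[ℂ] H} (h₁ : IsStarProjection P₁)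
    (h₂ : IsStarProjection P₂) {m : ℝ} (hA : ‖P₁ * A * (1 - P₂)‖ ≤ m)
    (hB : ‖(1 - P₁) * B * P₂‖ ≤ m) : ‖P₁ * A * (1 - P₂) + (1 - P₁) * B * P₂‖ ≤ m := by
  have hm : 0 ≤ m := (norm_nonneg _).trans hA
  refine ContinuousLinearMap.opNorm_le_bound _ hm fun x => ?_
  have e2 := h₂.isIdempotentElem.eq
  have eA : P₁ * A * (1 - P₂) = P₁ * A * (1 - P₂) * (1 - P₂) := by
    rw [mul_assoc (P₁ * A), h₂.one_sub.isIdempotentElem.eq]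
  have eB : (1 - P₁) * B * P₂ = (1 - P₁) * B * P₂ * P₂ := by
    rw [mul_assoc ((1 - P₁) * B), e2]
  have bA : ‖(P₁ * A * (1 - P₂)) x‖ ≤ m * ‖(1 - P₂) x‖ := by
    rw [eA]
    exact (ContinuousLinearMap.le_opNorm (P₁ * A * (1 - P₂)) ((1 - P₂) x)).trans
      (mul_le_mul_of_nonneg_right hA (norm_nonneg _))
  have bB : ‖((1 - P₁) * B * P₂) x‖ ≤ m * ‖P₂ x‖ := by
    rw [eB]
    exact (ContinuousLinearMap.le_opNorm ((1 - P₁) * B * P₂) (P₂ x)).trans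
      (mul_le_mul_of_nonneg_right hB (norm_nonneg _))
  have q1 := norm_sq_add_norm_sq_compl h₁ (A ((1 - P₂) x)) (B (P₂ x))
  have q2 := norm_sq_add_norm_sq_compl h₂ x x
  have e3 : P₂ x + (1 - P₂) x = x := by simp
  rw [e3] at q2
  refine abs_le_of_sq_le_sq' ?_ (by positivity) |>.2
  change ‖P₁ (A ((1 - P₂) x)) + (1 - P₁) (B (P₂ x))‖ ^ 2 ≤ _
  rw [q1, mul_pow, q2, mul_add, add_comm]
  change ‖((1 - P₁) * B * P₂) x‖ ^ 2 + ‖(P₁ * A * (1 - P₂)) x‖ ^ 2 ≤ _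
  gcongr
  · rw [← mul_pow]; gcongr
  · rw [← mul_pow]; gcongr

/-- The Sylvester equation `X W₂ - W₁ X = Y` is bounded below, with constant `δ`, on
off-diagonal operators. -/
def SylvesterBound (W₁ P₁ W₂ P₂ : H →L[ℂ] H) (δ : ℝ) : Prop :=
  ∀ X, δ * ‖offDiag P₁ P₂ X‖ ≤ ‖X * W₂ - W₁ * X‖

/-- The commutator with `W` maps onto the off-diagonal operators. -/
def SylvesterSolvable (W P : H →L[ℂ] H) : Prop :=
  ∀ Y, ∃ X, offDiag P P X = X ∧ X * W - W * X = offDiag P P Y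

/-- The circle of centre `z` separates the part of `W` on the range of `P`, inside radius `r`, from
the part of `W` on the complement, outside radius `ρ`. -/
structure DiscSeparated (W P : H →L[ℂ] H) (z : ℂ) (r ρ : ℝ) : Prop where
  proj : IsStarProjection P
  comm : Commute W P
  inner_le : ‖(W - algebraMap ℂ (H →L[ℂ] H) z) * P‖ ≤ r
  outer : ∃ G, (W - algebraMap ℂ (H →L[ℂ] H) z) * G = 1 - P ∧
    G * (W - algebraMap ℂ (H →L[ℂ] H) z) = 1 - P ∧ G * (1 - P) = G ∧ (1 - P) * G = G ∧ ρ * ‖G‖ ≤ 1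

lemma norm_le_of_eq_mul {A : Type*} [NormedRing A] {T Y B G : A} {r ρ : ℝ} (hρ : 0 < ρ) (hB : ‖B‖ ≤ r)
    (hG : ρ * ‖G‖ ≤ 1) (hT : ‖T‖ ≤ (‖Y‖ + ‖B‖ * ‖T‖) * ‖G‖) : (ρ - r) * ‖T‖ ≤ ‖Y‖ := by
  have h1 : ρ * ‖T‖ ≤ (‖Y‖ + ‖B‖ * ‖T‖) * (ρ * ‖G‖) := by nlinarith
  have h2 : (‖Y‖ + ‖B‖ * ‖T‖) * (ρ * ‖G‖) ≤ (‖Y‖ + ‖B‖ * ‖T‖) * 1 := by gcongr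
  have h3 : ‖B‖ * ‖T‖ ≤ r * ‖T‖ := by gcongr
  linarith

/-- Shifting both operators by `z` does not change `X W₂ - W₁ X`. In each off-diagonal block one
side of the equation is then contracted by `r` and the other can be divided out by the inverse `G`,
of norm at most `1 / ρ`. -/
lemma DiscSeparated.sylvesterBound {W₁ P₁ W₂ P₂ : H →L[ℂ] H} {z : ℂ} {r ρ : ℝ}
    (h₁ : DiscSeparated W₁ P₁ z r ρ) (h₂ : DiscSeparated W₂ P₂ z r ρ) (hr : 0 ≤ r) (hρ : r < ρ) :
    SylvesterBound W₁ P₁ W₂ P₂ (ρ - r) := by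
  intro X
  have hρ0 : 0 < ρ := hr.trans_lt hρ
  have hδ : 0 < ρ - r := sub_pos.2 hρ
  set Y := X * W₂ - W₁ * X with hY
  have cz : ∀ A, A * algebraMap ℂ (H →L[ℂ] H) z = algebraMap ℂ (H →L[ℂ] H) z * A :=
    fun A => (Algebra.commutes z A).symm
  set M₁ := W₁ - algebraMap ℂ (H →L[ℂ] H) z with hM₁
  set M₂ := W₂ - algebraMap ℂ (H →L[ℂ] H) z with hM₂
  have hXM : X * M₂ = Y + M₁ * X := by
    rw [hM₂, hY, hM₁, mul_sub, sub_mul, cz]; abel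
  have c1 : M₁ * P₁ = P₁ * M₁ := by rw [hM₁, sub_mul, mul_sub, h₁.comm.eq, cz]
  have c2 : M₂ * P₂ = P₂ * M₂ := by rw [hM₂, sub_mul, mul_sub, h₂.comm.eq, cz]
  have i1 := h₁.proj.isIdempotentElem.eq
  have i2 := h₂.proj.isIdempotentElem.eq
  obtain ⟨G₁, a1, a2, a3, a4, a5⟩ := h₁.outer
  obtain ⟨G₂, b1, b2, b3, b4, b5⟩ := h₂.outer
  have nP₁ := h₁.proj.norm_le
  have nQ₁ := h₁.proj.one_sub.norm_le
  have nP₂ := h₂.proj.norm_le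
  have nQ₂ := h₂.proj.one_sub.norm_le
  have k : ∀ {A B : H →L[ℂ] H}, ‖A‖ ≤ 1 → ‖B‖ ≤ 1 → ‖A * Y * B‖ ≤ ‖Y‖ := fun {A B} hA hB =>
    calc ‖A * Y * B‖ ≤ ‖A‖ * ‖Y‖ * ‖B‖ := norm_mul₃_le
      _ ≤ 1 * ‖Y‖ * 1 := by gcongr
      _ = ‖Y‖ := by ring
  have key : ‖offDiag P₁ P₂ X‖ ≤ ‖Y‖ / (ρ - r) := by
    refine norm_antidiagonal_le h₁.proj h₂.proj ?_ ?_
    · rw [le_div_iff₀' hδ]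
      refine (norm_le_of_eq_mul (T := P₁ * X * (1 - P₂)) (Y := P₁ * Y * (1 - P₂)) hρ0
        h₁.inner_le b5 ?_).trans (k nP₁ nQ₂)
      have e : P₁ * X * (1 - P₂) =
          (P₁ * Y * (1 - P₂) + M₁ * P₁ * (P₁ * X * (1 - P₂))) * G₂ := by
        have : P₁ * Y * (1 - P₂) + M₁ * P₁ * (P₁ * X * (1 - P₂)) = P₁ * X * M₂ * (1 - P₂) := by
          rw [mul_assoc P₁ X M₂, hXM, c1]
          simp only [mul_add, add_mul, ← mul_assoc]
          rw [mul_assoc P₁ M₁ P₁, c1, ← mul_assoc P₁ P₁ M₁, i1]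
        rw [this, mul_assoc _ (1 - P₂), b4, mul_assoc _ M₂, b1]
      calc ‖P₁ * X * (1 - P₂)‖ = _ := congrArg _ e
        _ ≤ _ := norm_mul_le _ _
        _ ≤ _ := by
          gcongr
          exact (norm_add_le _ _).trans (by gcongr; exact norm_mul_le _ _)
    · rw [le_div_iff₀' hδ]
      refine (norm_le_of_eq_mul (T := (1 - P₁) * X * P₂) (Y := (1 - P₁) * Y * P₂) hρ0
        h₂.inner_le a5 ?_).trans (k nQ₁ nP₂)
      have e : (1 - P₁) * X * P₂ =
          G₁ * (-((1 - P₁) * Y * P₂) + (1 - P₁) * X * P₂ * (M₂ * P₂)) := by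
        have : -((1 - P₁) * Y * P₂) + (1 - P₁) * X * P₂ * (M₂ * P₂) =
            (1 - P₁) * (M₁ * X) * P₂ := by
          have e1 : M₁ * X = X * M₂ - Y := by rw [hXM]; abel
          have e2 : P₂ * (M₂ * P₂) = M₂ * P₂ := by rw [c2, ← mul_assoc, i2]
          rw [mul_assoc _ P₂, e2, e1]
          simp only [mul_sub, sub_mul, mul_assoc]
          abel
        rw [this, ← mul_assoc, ← mul_assoc, ← mul_assoc, a3, a2]
      calc ‖(1 - P₁) * X * P₂‖ = _ := congrArg _ e
        _ ≤ _ := norm_mul_le _ _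
        _ ≤ ‖G₁‖ * (‖(1 - P₁) * Y * P₂‖ + ‖(1 - P₁) * X * P₂‖ * ‖M₂ * P₂‖) := by
          gcongr
          refine (norm_add_le _ _).trans ?_
          rw [norm_neg]
          gcongr
          exact norm_mul_le _ _
        _ = _ := by ring
  rwa [le_div_iff₀' hδ] at key

/-- The map `T ↦ B T G` is a contraction, so the identity minus it is invertible by the Neumann
series. -/
lemma exists_eq_add_mul_mul (B G Y : H →L[ℂ] H) (h : ‖B‖ * ‖G‖ < 1) :
    ∃ T, T = Y + B * T * G := by
  have hL : ‖ContinuousLinearMap.mulLeftRight ℂ (H →L[ℂ] H) B G‖ < 1 :=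
    (ContinuousLinearMap.opNorm_mulLeftRight_apply_apply_le ℂ (H →L[ℂ] H) B G).trans_lt h
  obtain ⟨u, hu⟩ := isUnit_one_sub_of_norm_lt_one hL
  refine ⟨(↑u⁻¹ : (H →L[ℂ] H) →L[ℂ] (H →L[ℂ] H)) Y, ?_⟩
  have e : (↑u * ↑u⁻¹ : (H →L[ℂ] H) →L[ℂ] (H →L[ℂ] H)) Y = Y := by simp
  rw [hu] at e
  have e' : (↑u⁻¹ : (H →L[ℂ] H) →L[ℂ] (H →L[ℂ] H)) Y -
      B * (↑u⁻¹ : (H →L[ℂ] H) →L[ℂ] (H →L[ℂ] H)) Y * G = Y := by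
    simpa using e
  exact sub_eq_iff_eq_add.1 e'

/-- Each block equation, divided by the outer part of `W - z`, becomes a fixed-point equation with
contraction factor at most `r / ρ`. -/
lemma DiscSeparated.sylvesterSolvable {W P : H →L[ℂ] H} {z : ℂ} {r ρ : ℝ}
    (h : DiscSeparated W P z r ρ) (hr : 0 ≤ r) (hρ : r < ρ) : SylvesterSolvable W P := by
  intro Y
  have hρ0 : 0 < ρ := hr.trans_lt hρ
  have cz : ∀ A, A * algebraMap ℂ (H →L[ℂ] H) z = algebraMap ℂ (H →L[ℂ] H) z * A :=
    fun A => (Algebra.commutes z A).symm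
  have hin := h.inner_le
  obtain ⟨G, a1, a2, a3, a4, a5⟩ := h.outer
  set M := W - algebraMap ℂ (H →L[ℂ] H) z with hM
  have c : M * P = P * M := by rw [hM, sub_mul, mul_sub, h.comm.eq, cz]
  have hWM : ∀ X, X * W - W * X = X * M - M * X := fun X => by
    rw [hM, mul_sub, sub_mul, cz]; abel
  have i := h.proj.isIdempotentElem.eq
  have i' := h.proj.one_sub.isIdempotentElem.eq
  have iPQ : P * (1 - P) = 0 := by rw [mul_sub, mul_one, i, sub_self]
  have iQP : (1 - P) * P = 0 := by rw [sub_mul, one_mul, i, sub_self]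
  have hc : ‖M * P‖ * ‖G‖ < 1 := by
    have : ‖M * P‖ * ‖G‖ ≤ r * ‖G‖ := by gcongr
    rcases (norm_nonneg G).eq_or_lt with hG | hG
    · rw [← hG, mul_zero]; exact one_pos
    · nlinarith
  obtain ⟨T, hT⟩ := exists_eq_add_mul_mul (M * P) G (P * Y * (1 - P) * G) hc
  obtain ⟨S, hS⟩ := exists_eq_add_mul_mul G (M * P) (-(G * ((1 - P) * Y * P))) (by rwa [mul_comm])
  have hMP : M * P = P * (M * P) := by rw [c, ← mul_assoc, i]
  -- The fixed-point equations themselves force `T` and `S` to lie in their blocks.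
  have hTQ : T * (1 - P) = T := by
    conv_rhs => rw [hT]
    conv_lhs => rw [hT]
    rw [add_mul, mul_assoc _ G, a3, mul_assoc _ G, a3]
  have hPT : P * T = T := by
    conv_rhs => rw [hT]
    conv_lhs => rw [hT]
    rw [mul_add]
    simp only [← mul_assoc]
    rw [i, mul_assoc P M P, ← hMP]
  have hSP : S * P = S := by
    conv_rhs => rw [hS]
    conv_lhs => rw [hS]
    simp only [add_mul, neg_mul, mul_assoc, i]
  have hQS : (1 - P) * S = S := by
    conv_rhs => rw [hS]
    conv_lhs => rw [hS]
    simp only [mul_add, mul_neg, ← mul_assoc, a4]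
  have hTM : T * M - M * T = P * Y * (1 - P) := by
    have : T * M = P * Y * (1 - P) + M * T := by
      conv_lhs => rw [hT]
      rw [add_mul, mul_assoc _ G, a2, mul_assoc _ G, a2, mul_assoc (P * Y), i', mul_assoc _ T, hTQ,
        mul_assoc M, hPT]
    rw [this]; abel
  have hSM : S * M - M * S = (1 - P) * Y * P := by
    have : M * S = -((1 - P) * Y * P) + S * M := by
      conv_lhs => rw [hS]
      rw [mul_add, mul_neg, ← mul_assoc, a1, ← mul_assoc M, ← mul_assoc M, a1, hQS, c, ← mul_assoc S, hSP]
      simp only [← mul_assoc, i']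
    rw [this]; abel
  have hTP : T * P = 0 := by rw [← hTQ, mul_assoc, iQP, mul_zero]
  have hQT : (1 - P) * T = 0 := by rw [← hPT, ← mul_assoc, iQP, zero_mul]
  have hPS : P * S = 0 := by rw [← hQS, ← mul_assoc, iPQ, zero_mul]
  have hSQ : S * (1 - P) = 0 := by rw [← hSP, mul_assoc, iPQ, mul_zero]
  refine ⟨T + S, ?_, ?_⟩
  · rw [offDiag, mul_add, mul_add, hPT, hPS, hQT, hQS, add_zero, zero_add, hTQ, hSP]
  · rw [hWM, offDiag, ← hTM, ← hSM]
    simp only [add_mul, mul_add]; abel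

end Sylvester

/-! ### Algebraic identities for two idempotents. -/

section Blocks

variable {A : Type*} [Ring A]

lemma IsIdempotentElem.mul_mul_self {P : A} (hP : IsIdempotentElem P) (X : A) :
    P * (P * X) = P * X := by
  rw [← mul_assoc, hP.eq]

lemma onDiag_sub (P X Y : A) : onDiag P P (X - Y) = onDiag P P X - onDiag P P Y := by
  unfold onDiag
  noncomm_ring

lemma eq_add_of_offDiag_eq {P X : A} (hP : IsIdempotentElem P) (hX : offDiag P P X = X) :
    X = P * X + X * P := by
  have h2 := IsIdempotentElem.mul_mul_self hP
  have e : P * offDiag P P X + offDiag P P X * P = offDiag P P X := by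
    unfold offDiag
    simp only [mul_add, add_mul, mul_sub, sub_mul, mul_assoc, mul_one, one_mul, hP.eq, h2]
    abel
  rw [hX] at e
  exact e.symm

/-- Being off-diagonal for `P` means `X = PX + XP`. Replacing `P` by `P'` in this identity leaves a
defect linear in `P' - P`, and that defect is the diagonal part up to a reflection. -/
lemma onDiag_eq_of_offDiag_eq {P P' X : A} (hP : IsIdempotentElem P)
    (hX : offDiag P P X = X) (hP' : IsIdempotentElem P') :
    onDiag P' P' X = (P' - (1 - P')) * ((P' - P) * X + X * (P' - P)) := by
  have h := eq_add_of_offDiag_eq hP hX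
  have h2 := IsIdempotentElem.mul_mul_self hP'
  have h1 : (P' - P) * X + X * (P' - P) = P' * X + X * P' - X := by
    conv_rhs => rw [h]
    conv_rhs => enter [1, 1]; rw [← h]
    conv_rhs => enter [1, 2]; rw [← h]
    noncomm_ring
  rw [h1, onDiag]
  simp only [mul_add, mul_sub, sub_mul, mul_assoc, mul_one, one_mul, h2]
  abel

/-- A difference of projections is off-diagonal to first order; what remains on the diagonal is
quadratic. -/
lemma onDiag_sub_left {P P' : A} (hP : IsIdempotentElem P) (hP' : IsIdempotentElem P') :
    onDiag P' P' (P' - P) = (P' - (1 - P')) * ((P' - P) * (P' - P)) := by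
  unfold onDiag
  have h2 := IsIdempotentElem.mul_mul_self hP'
  simp only [mul_sub, sub_mul, mul_assoc, mul_one, one_mul, hP.eq, hP'.eq, h2]
  abel

lemma onDiag_sub_right {P P' : A} (hP : IsIdempotentElem P) (hP' : IsIdempotentElem P') :
    onDiag P P (P' - P) = -((P - (1 - P)) * ((P' - P) * (P' - P))) := by
  unfold onDiag
  have h2 := IsIdempotentElem.mul_mul_self hP
  simp only [mul_sub, sub_mul, mul_assoc, mul_one, one_mul, hP.eq, hP'.eq, h2]
  abel

/-- This identifies the off-diagonal part of `S†`. The quadratic term is what makes the right side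
exactly off-diagonal. -/
lemma offDiag_transfer {P P' : A} (hP : IsIdempotentElem P) (hP' : IsIdempotentElem P') :
    offDiag P P (P * P' + (1 - P) * (1 - P')) =
      (P - (1 - P)) * (P' - P) + (P' - P) * (P' - P) := by
  unfold offDiag
  have h2 := IsIdempotentElem.mul_mul_self hP
  simp only [mul_add, add_mul, mul_sub, sub_mul, mul_assoc, mul_one, one_mul, hP.eq, hP'.eq, h2]
  abel

lemma transfer_sub_one {P : A} (P' : A) (hP : IsIdempotentElem P) :
    P * P' + (1 - P) * (1 - P') - 1 = (P - (1 - P)) * (P' - P) := by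
  simp only [mul_sub, sub_mul, mul_one, one_mul, hP.eq]
  abel

lemma transfer_mul_transfer {P P' : A} (hP : IsIdempotentElem P) (hP' : IsIdempotentElem P') :
    (P' * P + (1 - P') * (1 - P)) * (P * P' + (1 - P) * (1 - P')) =
      1 - (P' - P) * (P' - P) := by
  have h2 := IsIdempotentElem.mul_mul_self hP
  simp only [mul_add, add_mul, mul_sub, sub_mul, mul_assoc, mul_one, one_mul, hP.eq, hP'.eq, h2]
  abel

lemma transfer_mul_transfer' {P P' : A} (hP : IsIdempotentElem P) (hP' : IsIdempotentElem P') :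
    (P * P' + (1 - P) * (1 - P')) * (P' * P + (1 - P') * (1 - P)) =
      1 - (P' - P) * (P' - P) := by
  rw [transfer_mul_transfer hP' hP]
  noncomm_ring

end Blocks

/-- For `v ≥ 0` the operator `1 + v` is bounded below by 1, as pairing `(1 + v) X x` with `X x`
shows. -/
lemma norm_le_norm_one_add_mul {H : Type*} [NormedAddCommGroup H] [InnerProductSpace ℂ H]
    {v : H →L[ℂ] H} (hv : 0 ≤ v) (X : H →L[ℂ] H) :
    ‖X‖ ≤ ‖(1 + v) * X‖ := by
  refine ContinuousLinearMap.opNorm_le_bound _ (norm_nonneg _) fun x => ?_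
  refine le_trans ?_ (((1 + v) * X).le_opNorm x)
  have hp := (ContinuousLinearMap.nonneg_iff_isPositive v).1 hv
  have h1 : ‖X x‖ ^ 2 ≤ ‖X x‖ * ‖((1 + v) * X) x‖ := by
    have h2 : RCLike.re (inner ℂ (((1 + v) * X) x) (X x)) =
        ‖X x‖ ^ 2 + RCLike.re (inner ℂ (v (X x)) (X x)) := by
      have : ((1 + v) * X) x = X x + v (X x) := rfl
      rw [this, inner_add_left, map_add, inner_self_eq_norm_sq]
    have h3 := hp.re_inner_nonneg_left (X x)
    have h4 := re_inner_le_norm (𝕜 := ℂ) (((1 + v) * X) x) (X x)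
    linarith
  rcases (norm_nonneg (X x)).eq_or_lt with h0 | h0
  · rw [← h0]; positivity
  · nlinarith

/-! ### Differences of projections, correctors and the transfer unitary. -/

section Estimates

variable {H : Type*} [NormedAddCommGroup H] [InnerProductSpace ℂ H] [CompleteSpace H]

lemma reflection_mem_unitary {P : H →L[ℂ] H} (hP : IsStarProjection P) :
    P - (1 - P) ∈ unitary (H →L[ℂ] H) := by
  have h1 : star (P - (1 - P)) = P - (1 - P) := by
    simp [hP.isSelfAdjoint.star_eq]
  have h2 : (P - (1 - P)) * (P - (1 - P)) = 1 := by
    simp only [mul_sub, sub_mul, mul_one, one_mul, hP.isIdempotentElem.eq]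
    abel
  rw [Unitary.mem_iff, h1]
  exact ⟨h2, h2⟩

lemma norm_reflection_mul {P : H →L[ℂ] H} (hP : IsStarProjection P) (X : H →L[ℂ] H) :
    ‖(P - (1 - P)) * X‖ = ‖X‖ :=
  CStarRing.norm_mem_unitary_mul X (reflection_mem_unitary hP)

lemma norm_mul_reflection {P : H →L[ℂ] H} (hP : IsStarProjection P) (X : H →L[ℂ] H) :
    ‖X * (P - (1 - P))‖ = ‖X‖ :=
  CStarRing.norm_mul_mem_unitary X (reflection_mem_unitary hP)

/-- The commutator with `P` is half the commutator with the unitary reflection `2P - 1`, which gives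
the constant 1 in place of 2. -/
lemma norm_commutator_le {P : H →L[ℂ] H} (hP : IsStarProjection P) (X : H →L[ℂ] H) :
    ‖X * P - P * X‖ ≤ ‖X‖ := by
  have e : (X * P - P * X) + (X * P - P * X) = X * (P - (1 - P)) - (P - (1 - P)) * X := by
    noncomm_ring
  have h := norm_sub_le (X * (P - (1 - P))) ((P - (1 - P)) * X)
  rw [← e, ← two_smul ℝ, norm_smul, norm_mul_reflection hP, norm_reflection_mul hP] at h
  norm_num at h
  linarith

/-- The projections move by at most the step of the unitaries over the gap. -/
lemma SylvesterBound.norm_proj_sub_le {W W' P P' : H →L[ℂ] H} {δ : ℝ}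
    (h : SylvesterBound W' P' W P δ) (hP : IsStarProjection P) :
    δ * ‖P' - P‖ ≤ ‖W' - W‖ := by
  -- The off-diagonal part of the identity between two different decompositions is `P' - P` up to a
  -- reflection and a sign.
  have h1 := h 1
  have e : (P' - P) * (P - (1 - P)) = -offDiag P' P 1 := by
    unfold offDiag
    simp only [mul_sub, sub_mul, mul_one, one_mul, hP.isIdempotentElem.eq]
    abel
  rw [one_mul, mul_one, norm_sub_rev W W'] at h1
  rwa [← norm_mul_reflection hP, e, norm_neg]

/-- The second difference of the projections. -/
lemma SylvesterBound.norm_proj_second_diff_le {W W' W'' P P' P'' : H →L[ℂ] H} {δ : ℝ} (hδ : 0 ≤ δ)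
    (h : SylvesterBound W' P' W' P' δ) (hP : IsStarProjection P) (hP' : IsStarProjection P')
    (hP'' : IsStarProjection P'') (hc : Commute W P) (hc' : Commute W' P') (hc'' : Commute W'' P'') :
    δ * ‖(P'' - P') - (P' - P)‖ ≤ ‖(W'' - W') - (W' - W)‖ + 2 * (‖W'' - W'‖ * ‖P'' - P'‖)
      + 2 * (‖W' - W‖ * ‖P' - P‖) + δ * (‖P'' - P'‖ ^ 2 + ‖P' - P‖ ^ 2) := by
  set E := (P'' - P') - (P' - P) with hE
  set B := (W'' - W') - (W' - W) with hB
  -- This is the second difference of the identity `WP - PW = 0`, expanded by a Leibniz rule about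
  -- the middle time.
  have key : E * W' - W' * E = (B * P' - P' * B)
      + ((W'' - W') * (P'' - P') - (P'' - P') * (W'' - W'))
      + ((W' - W) * (P' - P) - (P' - P) * (W' - W)) := by
    have z1 : W * P - P * W = 0 := sub_eq_zero.2 hc.eq
    have z2 : W' * P' - P' * W' = 0 := sub_eq_zero.2 hc'.eq
    have z3 : W'' * P'' - P'' * W'' = 0 := sub_eq_zero.2 hc''.eq
    have : E * W' - W' * E = (B * P' - P' * B)
      + ((W'' - W') * (P'' - P') - (P'' - P') * (W'' - W'))
      + ((W' - W) * (P' - P) - (P' - P) * (W' - W)) - (W'' * P'' - P'' * W'')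
      - (W * P - P * W) + (W' * P' - P' * W') + (W' * P' - P' * W') := by
      rw [hE, hB]; noncomm_ring
    rw [this, z1, z2, z3]; abel
  have n1 : ‖E * W' - W' * E‖ ≤ ‖B‖ + 2 * (‖W'' - W'‖ * ‖P'' - P'‖)
      + 2 * (‖W' - W‖ * ‖P' - P‖) := by
    have c : ∀ X Y : H →L[ℂ] H, ‖X * Y - Y * X‖ ≤ 2 * (‖X‖ * ‖Y‖) := fun X Y => by
      refine (norm_sub_le _ _).trans ?_
      have := norm_mul_le X Y
      have := norm_mul_le Y X
      linarith
    rw [key]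
    refine (norm_add₃_le).trans ?_
    gcongr
    · exact norm_commutator_le hP' B
    · exact c _ _
    · exact c _ _
  have n2 : ‖onDiag P' P' E‖ ≤ ‖P'' - P'‖ ^ 2 + ‖P' - P‖ ^ 2 := by
    rw [hE, onDiag_sub, onDiag_sub_left hP.isIdempotentElem hP'.isIdempotentElem,
      onDiag_sub_right hP'.isIdempotentElem hP''.isIdempotentElem]
    refine (norm_sub_le _ _).trans ?_
    rw [norm_neg, norm_reflection_mul hP', norm_reflection_mul hP', sq, sq]
    gcongr <;> exact norm_mul_le _ _
  have n3 : ‖E‖ ≤ ‖offDiag P' P' E‖ + ‖onDiag P' P' E‖ := by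
    conv_lhs => rw [← offDiag_add_onDiag P' P' E]
    exact norm_add_le _ _
  have n4 := h E
  nlinarith

/-- The first-order, off-diagonal part of `V† - 1`. -/
def offTransfer (P' P : H →L[ℂ] H) : H →L[ℂ] H :=
  (P - (1 - P)) * (P' - P) + (P' - P) * (P' - P)

lemma norm_offTransfer_le {P P' : H →L[ℂ] H} (hP : IsStarProjection P) :
    ‖offTransfer P' P‖ ≤ ‖P' - P‖ + ‖P' - P‖ ^ 2 := by
  refine (norm_add_le _ _).trans ?_
  rw [norm_reflection_mul hP, sq]
  gcongr
  exact norm_mul_le _ _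

/-- The change of the reflection contributes `2 (P' - P)²`, which turns the sign of the `-(P' - P)²`
coming from the earlier step. -/
lemma norm_offTransfer_sub_le {P P' P'' : H →L[ℂ] H} (hP' : IsStarProjection P') :
    ‖offTransfer P'' P' - offTransfer P' P‖ ≤
      ‖(P'' - P') - (P' - P)‖ + ‖P'' - P'‖ ^ 2 + ‖P' - P‖ ^ 2 := by
  have e : offTransfer P'' P' - offTransfer P' P =
      (P' - (1 - P')) * ((P'' - P') - (P' - P)) + (P'' - P') * (P'' - P')
        + (P' - P) * (P' - P) := by
    unfold offTransfer
    noncomm_ring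
  rw [e]
  refine norm_add₃_le.trans ?_
  rw [norm_reflection_mul hP', sq, sq]
  gcongr <;> exact norm_mul_le _ _

/-- `X` solves the commutator equation that removes the first-order part `O` of the step. -/
structure IsCorrector (W P O X : H →L[ℂ] H) : Prop where
  offDiag_eq : offDiag P P X = X
  eq : X * W - W * X = O * W

/-- Solve with right side `S† W`: since `W` commutes with `P`, its off-diagonal part is that of `S†`
times `W`. -/
lemma SylvesterSolvable.exists_isCorrector {W P P' : H →L[ℂ] H} (h : SylvesterSolvable W P)
    (hP : IsStarProjection P) (hP' : IsStarProjection P') (hc : Commute W P) :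
    ∃ X, IsCorrector W P (offTransfer P' P) X := by
  obtain ⟨X, h1, h2⟩ := h ((P * P' + (1 - P) * (1 - P')) * W)
  refine ⟨X, h1, ?_⟩
  rw [h2, offTransfer, ← offDiag_transfer hP.isIdempotentElem hP'.isIdempotentElem]
  have hc1 : W * (1 - P) = (1 - P) * W := by rw [mul_sub, sub_mul, hc.eq, mul_one, one_mul]
  generalize P * P' + (1 - P) * (1 - P') = K
  simp only [offDiag, add_mul _ _ W, mul_assoc, hc.eq, hc1]

lemma IsCorrector.norm_le {W P O X : H →L[ℂ] H} {δ : ℝ} (hX : IsCorrector W P O X)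
    (hW : W ∈ unitary (H →L[ℂ] H)) (h : SylvesterBound W P W P δ) : δ * ‖X‖ ≤ ‖O‖ := by
  have := h X
  rwa [hX.offDiag_eq, hX.eq, CStarRing.norm_mul_mem_unitary _ hW] at this

/-- Subtracting the two corrector equations gives a Sylvester equation for `X' - X` at `W'`, which
controls only its `P'`-off-diagonal part. The diagonal part comes from `X` alone and is small
because `P` is close to `P'`. -/
lemma IsCorrector.norm_step_le {W W' P P' O O' X X' : H →L[ℂ] H} {δ : ℝ} (hδ : 0 ≤ δ)
    (hX : IsCorrector W P O X) (hX' : IsCorrector W' P' O' X') (hP : IsStarProjection P)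
    (hP' : IsStarProjection P') (hW' : W' ∈ unitary (H →L[ℂ] H))
    (h : SylvesterBound W' P' W' P' δ) :
    δ * ‖X' - X‖ ≤ ‖O' - O‖ + ‖O‖ * ‖W' - W‖ + 2 * (‖X‖ * ‖W' - W‖)
      + δ * (2 * (‖P' - P‖ * ‖X‖)) := by
  have key : (X' - X) * W' - W' * (X' - X) =
      (O' - O) * W' + O * (W' - W) - X * (W' - W) + (W' - W) * X := by
    have : (X' - X) * W' - W' * (X' - X) = (X' * W' - W' * X') - (X * W - W * X)
      - X * (W' - W) + (W' - W) * X := by noncomm_ring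
    rw [this, hX.eq, hX'.eq]; noncomm_ring
  have n1 : ‖(X' - X) * W' - W' * (X' - X)‖ ≤
      ‖O' - O‖ + ‖O‖ * ‖W' - W‖ + 2 * (‖X‖ * ‖W' - W‖) := by
    rw [key]
    refine (norm_add_le _ _).trans ?_
    have a1 := norm_sub_le ((O' - O) * W' + O * (W' - W)) (X * (W' - W))
    have a2 := norm_add_le ((O' - O) * W') (O * (W' - W))
    have a3 := norm_mul_le O (W' - W)
    have a4 := norm_mul_le X (W' - W)
    have a5 := norm_mul_le (W' - W) X
    rw [CStarRing.norm_mul_mem_unitary _ hW'] at a2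
    linarith
  have n2 : ‖onDiag P' P' (X' - X)‖ ≤ 2 * (‖P' - P‖ * ‖X‖) := by
    have e : onDiag P' P' X' = 0 := by
      have h1 := offDiag_add_onDiag P' P' X'
      rw [hX'.offDiag_eq] at h1
      simpa using h1
    rw [onDiag_sub, e, zero_sub, norm_neg,
      onDiag_eq_of_offDiag_eq hP.isIdempotentElem hX.offDiag_eq hP'.isIdempotentElem,
      norm_reflection_mul hP']
    have a1 := norm_add_le ((P' - P) * X) (X * (P' - P))
    have a2 := norm_mul_le (P' - P) X
    have a3 := norm_mul_le X (P' - P)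
    linarith
  have n3 : ‖X' - X‖ ≤ ‖offDiag P' P' (X' - X)‖ + ‖onDiag P' P' (X' - X)‖ := by
    conv_lhs => rw [← offDiag_add_onDiag P' P' (X' - X)]
    exact norm_add_le _ _
  have n4 := h (X' - X)
  nlinarith

lemma star_transferS {P P' : H →L[ℂ] H} (hP : IsStarProjection P) (hP' : IsStarProjection P') :
    star (transferS P' P) = P * P' + (1 - P) * (1 - P') := by
  simp [transferS, hP.isSelfAdjoint.star_eq, hP'.isSelfAdjoint.star_eq]

section Transfer

variable {P P' : H →L[ℂ] H}

lemma transferAbs_mul_self (hP : IsStarProjection P) (hP' : IsStarProjection P') :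
    transferAbs P' P * transferAbs P' P = 1 - (P' - P) * (P' - P) := by
  rw [transferAbs, CFC.sqrt_mul_sqrt_self _ (mul_star_self_nonneg _), star_transferS hP hP',
    transferS, transfer_mul_transfer hP.isIdempotentElem hP'.isIdempotentElem]

lemma isUnit_one_sub_sq (hd : ‖P' - P‖ < 1) : IsUnit (1 - (P' - P) * (P' - P)) := by
  refine isUnit_one_sub_of_norm_lt_one ((norm_mul_le _ _).trans_lt ?_)
  nlinarith [norm_nonneg (P' - P)]

lemma isUnit_transferAbs (hP : IsStarProjection P) (hP' : IsStarProjection P')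
    (hd : ‖P' - P‖ < 1) : IsUnit (transferAbs P' P) := by
  have h := isUnit_one_sub_sq hd
  rw [← transferAbs_mul_self hP hP'] at h
  exact ((Commute.refl (transferAbs P' P)).isUnit_mul_iff.1 h).1

lemma transferAbs_mul_transferV (hP : IsStarProjection P) (hP' : IsStarProjection P')
    (hd : ‖P' - P‖ < 1) : transferAbs P' P * transferV P' P = transferS P' P := by
  rw [transferV, ← mul_assoc, Ring.mul_inverse_cancel _ (isUnit_transferAbs hP hP' hd), one_mul]

lemma isSelfAdjoint_transferAbs : star (transferAbs P' P) = transferAbs P' P :=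
  (CFC.sqrt_nonneg _).isSelfAdjoint.star_eq

/-- Cancelling `v` on both sides of `v V V† v = S S† = v²` gives `V V† = 1`. The other identity
needs `V` invertible, which holds because `S` and `S†` commute and have invertible product. -/
lemma transferV_mem_unitary (hP : IsStarProjection P) (hP' : IsStarProjection P')
    (hd : ‖P' - P‖ < 1) : transferV P' P ∈ unitary (H →L[ℂ] H) := by
  have hv := isUnit_transferAbs hP hP' hd
  have hV := transferAbs_mul_transferV hP hP' hd
  have h1 : transferV P' P * star (transferV P' P) = 1 := by
    have e : transferAbs P' P * (transferV P' P * star (transferV P' P)) * transferAbs P' P =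
        transferAbs P' P * 1 * transferAbs P' P := by
      have : transferAbs P' P * (transferV P' P * star (transferV P' P)) * transferAbs P' P =
          (transferAbs P' P * transferV P' P) * star (transferAbs P' P * transferV P' P) := by
        rw [star_mul, isSelfAdjoint_transferAbs]; simp only [mul_assoc]
      rw [this, hV, star_transferS hP hP', transferS,
        transfer_mul_transfer hP.isIdempotentElem hP'.isIdempotentElem, mul_one,
        transferAbs_mul_self hP hP']
    exact hv.mul_left_cancel (hv.mul_right_cancel e)
  have hS : IsUnit (transferS P' P) := by
    have hu := isUnit_one_sub_sq hd
    have c : Commute (P' * P + (1 - P') * (1 - P)) (P * P' + (1 - P) * (1 - P')) := by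
      rw [Commute, SemiconjBy, transfer_mul_transfer hP.isIdempotentElem hP'.isIdempotentElem,
        transfer_mul_transfer' hP.isIdempotentElem hP'.isIdempotentElem]
    rw [← transfer_mul_transfer hP.isIdempotentElem hP'.isIdempotentElem] at hu
    exact (c.isUnit_mul_iff.1 hu).1
  have hVu : IsUnit (transferV P' P) := by
    rw [transferV]
    exact (isUnit_ringInverse.2 hv).mul hS
  refine Unitary.mem_iff.2 ⟨?_, h1⟩
  refine hVu.mul_left_cancel ?_
  rw [← mul_assoc, h1, one_mul, mul_one]

/-- Factor `1 - v² = (P' - P)²` as `(1 + v)(1 - v)` and discard `1 + v`, which is bounded below by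
1. -/
lemma norm_one_sub_transferAbs_le (hP : IsStarProjection P) (hP' : IsStarProjection P') :
    ‖1 - transferAbs P' P‖ ≤ ‖P' - P‖ ^ 2 := by
  have e : (1 + transferAbs P' P) * (1 - transferAbs P' P) = (P' - P) * (P' - P) := by
    have : (1 + transferAbs P' P) * (1 - transferAbs P' P) =
        1 - transferAbs P' P * transferAbs P' P := by noncomm_ring
    rw [this, transferAbs_mul_self hP hP']; abel
  have h := norm_le_norm_one_add_mul (v := transferAbs P' P) (CFC.sqrt_nonneg _)
    (1 - transferAbs P' P)
  rw [e] at h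
  rw [sq]
  exact h.trans (norm_mul_le _ _)

/-- From `S† = V† v`, one has `V† - 1 = (S† - 1) + V†(1 - v)`, whose last term is of second order.
-/
lemma star_transferV_sub_one (hP : IsStarProjection P) (hP' : IsStarProjection P')
    (hd : ‖P' - P‖ < 1) :
    star (transferV P' P) - 1 = (P - (1 - P)) * (P' - P)
      + star (transferV P' P) * (1 - transferAbs P' P) := by
  have h := congrArg star (transferAbs_mul_transferV hP hP' hd)
  rw [star_mul, isSelfAdjoint_transferAbs, star_transferS hP hP'] at h
  rw [← transfer_sub_one P' hP.isIdempotentElem, ← h, mul_sub, mul_one]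
  abel

lemma norm_star_transferV_sub_one_le (hP : IsStarProjection P) (hP' : IsStarProjection P')
    (hd : ‖P' - P‖ < 1) : ‖star (transferV P' P) - 1‖ ≤ ‖P' - P‖ + ‖P' - P‖ ^ 2 := by
  rw [star_transferV_sub_one hP hP' hd]
  refine (norm_add_le _ _).trans ?_
  have hV := Unitary.star_mem (transferV_mem_unitary hP hP' hd)
  have h := norm_one_sub_transferAbs_le hP hP'
  rw [norm_reflection_mul hP]
  generalize star (transferV P' P) = V at *
  generalize transferAbs P' P = v at *
  rw [CStarRing.norm_mem_unitary_mul (1 - v) hV]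
  exact add_le_add le_rfl h

lemma norm_star_transferV_sub_one_sub_le (hP : IsStarProjection P) (hP' : IsStarProjection P')
    (hd : ‖P' - P‖ < 1) :
    ‖star (transferV P' P) - 1 - offTransfer P' P‖ ≤ 2 * ‖P' - P‖ ^ 2 := by
  have e : star (transferV P' P) - 1 - offTransfer P' P =
      star (transferV P' P) * (1 - transferAbs P' P) - (P' - P) * (P' - P) := by
    rw [star_transferV_sub_one hP hP' hd, offTransfer]; abel
  rw [e]
  refine (norm_sub_le _ _).trans ?_
  have hV := Unitary.star_mem (transferV_mem_unitary hP hP' hd)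
  have h1 := norm_one_sub_transferAbs_le hP hP'
  have h2 := norm_mul_le (P' - P) (P' - P)
  generalize star (transferV P' P) = V at *
  generalize transferAbs P' P = v at *
  rw [CStarRing.norm_mem_unitary_mul (1 - v) hV]
  nlinarith

end Transfer

end Estimates

/-! ### Separating two arcs by a circle. -/

section Arcs

lemma norm_exp_mul_I_sub (θ c : ℝ) :
    ‖Complex.exp (θ * Complex.I) - Complex.exp (c * Complex.I)‖ = 2 * |Real.sin ((θ - c) / 2)| := by
  have e : Complex.exp (θ * Complex.I) - Complex.exp (c * Complex.I) =
      Complex.exp (c * Complex.I) * (Complex.exp (Complex.I * ((θ - c : ℝ) : ℂ)) - 1) := by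
    rw [mul_sub, ← Complex.exp_add, mul_one]
    congr 2
    push_cast; ring
  rw [e, norm_mul, Complex.norm_exp_ofReal_mul_I, one_mul, Complex.norm_exp_I_mul_ofReal_sub_one,
    norm_mul, Real.norm_eq_abs, Real.norm_eq_abs, abs_two]

lemma angle_exp_le_abs (x y : ℝ) :
    InnerProductGeometry.angle (Complex.exp (x * Complex.I)) (Complex.exp (y * Complex.I)) ≤
      |x - y| := by
  by_cases h : |x - y| < Real.pi
  · rw [Complex.angle_exp_exp, (toIocMod_eq_self Real.two_pi_pos).2]
    rw [abs_lt] at h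
    constructor <;> linarith
  · exact (InnerProductGeometry.angle_le_pi _ _).trans (not_lt.1 h)

lemma angularDist_le {A B : Set ℂ} {x y : ℂ} (hx : x ∈ A) (hy : y ∈ B) :
    angularDist A B ≤ InnerProductGeometry.angle x y :=
  csInf_le ⟨0, by rintro _ ⟨u, -, v, -, rfl⟩; exact InnerProductGeometry.angle_nonneg _ _⟩
    ⟨x, hx, y, hy, rfl⟩

lemma angularDist_comm (A B : Set ℂ) : angularDist A B = angularDist B A := by
  rw [angularDist, angularDist, Set.image2_swap]
  congr 1
  simp only [InnerProductGeometry.angle_comm]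

lemma IsArc.isCompact {A : Set ℂ} (hA : IsArc A) : IsCompact A := by
  obtain ⟨a, b, -, rfl⟩ := hA
  exact isCompact_Icc.image (by fun_prop)

lemma IsArc.nonempty {A : Set ℂ} (hA : IsArc A) : A.Nonempty := by
  obtain ⟨a, b, h, rfl⟩ := hA
  exact (Set.nonempty_Icc.2 h).image _

lemma IsArc.norm_eq_one {A : Set ℂ} (hA : IsArc A) {x : ℂ} (hx : x ∈ A) : ‖x‖ = 1 := by
  obtain ⟨a, b, h, rfl⟩ := hA
  obtain ⟨θ, -, rfl⟩ := hx
  exact Complex.norm_exp_ofReal_mul_I θ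

/-- The arcs are compact, so the infimum is attained, and two unit vectors at angle 0 coincide. -/
lemma angularDist_pos {A B : Set ℂ} (hA : IsArc A) (hB : IsArc B) (h : Disjoint A B) :
    0 < angularDist A B := by
  have hne : ∀ {x}, ‖x‖ = 1 → x ≠ (0 : ℂ) := fun h => by
    rw [← norm_ne_zero_iff, h]; exact one_ne_zero
  have hc : IsCompact (Set.image2 InnerProductGeometry.angle A B) := by
    rw [← Set.image_prod]
    refine (hA.isCompact.prod hB.isCompact).image_of_continuousOn fun p hp => ?_
    exact (InnerProductGeometry.continuousAt_angle (hne (hA.norm_eq_one hp.1))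
      (hne (hB.norm_eq_one hp.2))).continuousWithinAt
  obtain ⟨x, hx, y, hy, hxy⟩ := hc.sInf_mem (hA.nonempty.image2 hB.nonempty)
  rw [angularDist, ← hxy]
  refine (InnerProductGeometry.angle_nonneg _ _).lt_of_ne fun h0 => ?_
  obtain ⟨-, r, hr, e⟩ := InnerProductGeometry.angle_eq_zero_iff.1 h0.symm
  have : ‖y‖ = r * ‖x‖ := by rw [e, norm_smul, Real.norm_of_nonneg hr.le]
  rw [hA.norm_eq_one hx, hB.norm_eq_one hy, mul_one] at this
  rw [← this, one_smul] at e
  exact Set.disjoint_left.1 h hx (e ▸ hy)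

lemma angularDist_le_pi {A B : Set ℂ} (hA : IsArc A) (hB : IsArc B) :
    angularDist A B ≤ Real.pi := by
  obtain ⟨x, hx⟩ := hA.nonempty
  obtain ⟨y, hy⟩ := hB.nonempty
  exact (angularDist_le hx hy).trans (InnerProductGeometry.angle_le_pi _ _)

/-- The difference of the right and left sine terms is `4 sin (Δ/4) cos ((2p + Δ)/4)`. Both angles
are at most `π/4`, so it is at least `4 · 0.85 · (Δ/4) · 0.7 > Δ/2`. -/
lemma half_le_two_mul_sin_sub {p Δ : ℝ} (hp : 0 ≤ p) (hΔ : 0 < Δ) (h : 2 * p + Δ ≤ Real.pi) :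
    2 * Real.sin (p / 2) + Δ / 2 ≤ 2 * Real.sin ((p + Δ) / 2) := by
  have hπ := Real.pi_lt_d2
  have e : Real.sin ((p + Δ) / 2) - Real.sin (p / 2) =
      2 * Real.sin (Δ / 4) * Real.cos ((2 * p + Δ) / 4) := by
    rw [Real.sin_sub_sin]
    congr 2 <;> ring_nf
  have hc : Real.cos (Real.pi / 4) ≤ Real.cos ((2 * p + Δ) / 4) :=
    Real.cos_le_cos_of_nonneg_of_le_pi (by positivity) (by linarith) (by linarith)
  rw [Real.cos_pi_div_four] at hc
  have h2 : (1.4 : ℝ) ≤ √2 := Real.le_sqrt_of_sq_le (by norm_num)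
  have hs := Real.sin_gt_sub_cube (x := Δ / 4) (by positivity)
  have hs' : 0.85 * (Δ / 4) ≤ Real.sin (Δ / 4) := by
    have : (Δ / 4) ^ 2 ≤ 0.7 := by
      have : Δ / 4 ≤ 0.7875 := by linarith
      nlinarith
    nlinarith
  have : 0.85 * (Δ / 4) * 0.7 ≤ Real.sin (Δ / 4) * Real.cos ((2 * p + Δ) / 4) := by
    gcongr
    · linarith
    · linarith
  linarith

lemma image_exp_Icc_add (a b : ℝ) (m : ℤ) :
    (fun θ : ℝ => Complex.exp (θ * Complex.I)) '' Set.Icc a b =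
      (fun θ : ℝ => Complex.exp (θ * Complex.I)) ''
        Set.Icc (a + m * (2 * Real.pi)) (b + m * (2 * Real.pi)) := by
  have per : ∀ θ : ℝ, Complex.exp (((θ + m * (2 * Real.pi) : ℝ) : ℂ) * Complex.I) =
      Complex.exp (θ * Complex.I) := fun θ => by
    rw [Complex.exp_eq_exp_iff_exists_int]
    exact ⟨m, by push_cast; ring⟩
  ext w
  constructor
  · rintro ⟨θ, ⟨h1, h2⟩, rfl⟩
    exact ⟨θ + m * (2 * Real.pi), ⟨by linarith, by linarith⟩, per θ⟩
  · rintro ⟨θ, ⟨h1, h2⟩, rfl⟩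
    refine ⟨θ - m * (2 * Real.pi), ⟨by linarith, by linarith⟩, ?_⟩
    simp only
    rw [← per]
    simp

/-- The centre is the midpoint of the shorter arc `A`, of half-length `p`. The chord at angular
distance `t` has length `2 sin (t/2)`, so `A` lies within `2 sin (p/2)` and `B` beyond `2 sin ((p +
Δ)/2)`. -/
lemma exists_disc_of_length_le {a b a' b' : ℝ} (hab : a ≤ b) (hab' : a' ≤ b')
    (hlen : b - a ≤ b' - a') {A B : Set ℂ}
    (hA : A = (fun θ : ℝ => Complex.exp (θ * Complex.I)) '' Set.Icc a b)
    (hB : B = (fun θ : ℝ => Complex.exp (θ * Complex.I)) '' Set.Icc a' b')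
    (h : Disjoint A B) :
    ∃ (z : ℂ) (r ρ : ℝ), 0 ≤ r ∧ r + angularDist A B / 2 ≤ ρ ∧
      (∀ w ∈ A, ‖w - z‖ ≤ r) ∧ ∀ w ∈ B, ρ ≤ ‖w - z‖ := by
  have iA : IsArc A := ⟨a, b, hab, hA⟩
  have iB : IsArc B := ⟨a', b', hab', hB⟩
  set Δ := angularDist A B with hΔ
  have hΔ0 : 0 < Δ := angularDist_pos iA iB h
  have hΔπ : Δ ≤ Real.pi := angularDist_le_pi iA iB
  set c := (a + b) / 2 with hc
  set p := (b - a) / 2 with hp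
  have hp0 : 0 ≤ p := by rw [hp]; linarith
  -- Lift `B` so that it starts within one turn after `c`; disjointness from `A` then confines it
  -- between `A` and the next copy of `A`.
  obtain ⟨m, hm⟩ : ∃ m : ℤ, a' + m * (2 * Real.pi) ∈ Set.Ico c (c + 2 * Real.pi) := by
    refine ⟨-toIcoDiv Real.two_pi_pos c a', ?_⟩
    have := sub_toIcoDiv_zsmul_mem_Ico Real.two_pi_pos c a'
    rw [zsmul_eq_mul] at this
    push_cast
    rwa [neg_mul, ← sub_eq_add_neg]
  rw [image_exp_Icc_add a' b' m] at hB
  have hlen' : b - a ≤ (b' + m * (2 * Real.pi)) - (a' + m * (2 * Real.pi)) := by linarith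
  have hab'' : a' + m * (2 * Real.pi) ≤ b' + m * (2 * Real.pi) := by linarith
  generalize a' + m * (2 * Real.pi) = α at *
  generalize b' + m * (2 * Real.pi) = β at *
  have mA : ∀ θ : ℝ, c - p ≤ θ → θ ≤ c + p → Complex.exp (θ * Complex.I) ∈ A := fun θ h1 h2 => by
    rw [hA]; exact ⟨θ, ⟨by linarith, by linarith⟩, rfl⟩
  have mB : ∀ θ : ℝ, α ≤ θ → θ ≤ β → Complex.exp (θ * Complex.I) ∈ B := fun θ h1 h2 => by
    rw [hB]; exact ⟨θ, ⟨h1, h2⟩, rfl⟩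
  have per : ∀ θ : ℝ, Complex.exp (((θ + 2 * Real.pi : ℝ) : ℂ) * Complex.I) =
      Complex.exp (θ * Complex.I) := fun θ => by
    rw [Complex.exp_eq_exp_iff_exists_int]
    exact ⟨1, by push_cast; ring⟩
  have hβ : β < c + 2 * Real.pi := by
    by_contra hcon
    have h1 := mB (c + 2 * Real.pi) hm.2.le (not_lt.1 hcon)
    rw [per] at h1
    exact Set.disjoint_left.1 h (mA c (by linarith) (by linarith)) h1
  have lower : ∀ θ, α ≤ θ → θ ≤ β → c + p + Δ ≤ θ := fun θ h1 h2 => by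
    have hlt : c + p < θ := by
      by_contra hcon
      exact Set.disjoint_left.1 h (mA θ (by linarith [hm.1]) (not_lt.1 hcon)) (mB θ h1 h2)
    have h3 := (angularDist_le (mA (c + p) (by linarith) le_rfl) (mB θ h1 h2)).trans
      (angle_exp_le_abs _ _)
    rw [abs_of_neg (by linarith)] at h3
    linarith
  have upper : ∀ θ, α ≤ θ → θ ≤ β → θ ≤ c + 2 * Real.pi - p - Δ := fun θ h1 h2 => by
    have hlt : θ < c + 2 * Real.pi - p := by
      by_contra hcon
      have h4 := mA (θ - 2 * Real.pi) (by linarith) (by linarith)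
      rw [← per, sub_add_cancel] at h4
      exact Set.disjoint_left.1 h h4 (mB θ h1 h2)
    have h3 := mA (c - p) le_rfl (by linarith)
    rw [← per] at h3
    have h3 := (angularDist_le h3 (mB θ h1 h2)).trans (angle_exp_le_abs _ _)
    rw [abs_of_pos (by linarith)] at h3
    linarith
  -- One turn must hold both arcs and two gaps, and `B` is at least as long as `A`: `4p + 2Δ ≤ 2π`.
  have hpΔ : 2 * p + Δ ≤ Real.pi := by
    have h1 := lower α le_rfl hab''
    have h2 := upper β hab'' le_rfl
    have : 2 * p = b - a := by rw [hp]; ring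
    linarith
  refine ⟨Complex.exp (c * Complex.I), 2 * Real.sin (p / 2), 2 * Real.sin ((p + Δ) / 2), ?_,
    half_le_two_mul_sin_sub hp0 hΔ0 hpΔ, ?_, ?_⟩
  · have := Real.sin_nonneg_of_nonneg_of_le_pi (x := p / 2) (by linarith) (by linarith)
    linarith
  · intro w hw
    rw [hA] at hw
    obtain ⟨θ, ⟨h1, h2⟩, rfl⟩ := hw
    simp only
    rw [norm_exp_mul_I_sub]
    have h3 : |(θ - c) / 2| ≤ p / 2 := by
      rw [abs_le]; constructor <;> linarith
    rw [Real.abs_sin_eq_sin_abs_of_abs_le_pi (by linarith [Real.pi_pos])]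
    gcongr
    exact Real.sin_le_sin_of_le_of_le_pi_div_two (by linarith [abs_nonneg ((θ - c) / 2)])
      (by linarith) h3
  · intro w hw
    rw [hB] at hw
    obtain ⟨θ, ⟨h1, h2⟩, rfl⟩ := hw
    simp only
    rw [norm_exp_mul_I_sub]
    have h3 := lower θ h1 h2
    have h4 := upper θ h1 h2
    gcongr
    refine le_trans ?_ (le_abs_self _)
    rcases le_total ((θ - c) / 2) (Real.pi / 2) with h5 | h5
    · exact Real.sin_le_sin_of_le_of_le_pi_div_two (by linarith) h5 (by linarith)
    · rw [← Real.sin_pi_sub ((θ - c) / 2)]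
      exact Real.sin_le_sin_of_le_of_le_pi_div_two (by linarith) (by linarith) (by linarith)

lemma IsArc.exists_disc {A B : Set ℂ} (hA : IsArc A) (hB : IsArc B) (h : Disjoint A B) :
    ∃ (z : ℂ) (r ρ : ℝ), 0 ≤ r ∧ r + angularDist A B / 2 ≤ ρ ∧
      (((∀ w ∈ A, ‖w - z‖ ≤ r) ∧ ∀ w ∈ B, ρ ≤ ‖w - z‖) ∨
        ((∀ w ∈ B, ‖w - z‖ ≤ r) ∧ ∀ w ∈ A, ρ ≤ ‖w - z‖)) := by
  obtain ⟨a, b, hab, eA⟩ := hA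
  obtain ⟨a', b', hab', eB⟩ := hB
  rcases le_total (b - a) (b' - a') with hl | hl
  · obtain ⟨z, r, ρ, h1, h2, h3⟩ := exists_disc_of_length_le hab hab' hl eA eB h
    exact ⟨z, r, ρ, h1, h2, Or.inl h3⟩
  · obtain ⟨z, r, ρ, h1, h2, h3⟩ := exists_disc_of_length_le hab' hab hl eB eA h.symm
    rw [angularDist_comm] at h2
    exact ⟨z, r, ρ, h1, h2, Or.inr h3⟩

end Arcs

/-! ### From spectra in arcs to Sylvester bounds, by functional calculus. -/

section Spectral

lemma SylvesterBound.mono {H : Type*} [NormedAddCommGroup H] [InnerProductSpace ℂ H]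
    {W₁ P₁ W₂ P₂ : H →L[ℂ] H} {δ δ' : ℝ} (h : SylvesterBound W₁ P₁ W₂ P₂ δ) (hδ : δ' ≤ δ) : SylvesterBound W₁ P₁ W₂ P₂ δ' :=
  fun X => (mul_le_mul_of_nonneg_right hδ (norm_nonneg _)).trans (h X)

variable {H : Type*} [NormedAddCommGroup H] [InnerProductSpace ℂ H] [CompleteSpace H]

/-- The two parts of the spectrum of the normal operator `W` lie in `A`, respectively `B`. -/
structure SpectrumSplits (W : H →L[ℂ] H) (σ τ A B : Set ℂ) : Prop where
  normal : IsStarNormal W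
  union_eq : σ ∪ τ = spectrum ℂ W
  disjoint : Disjoint σ τ
  subset_left : σ ⊆ A
  subset_right : τ ⊆ B

variable {W : H →L[ℂ] H} {σ τ A B : Set ℂ}

lemma SpectrumSplits.symm (h : SpectrumSplits W σ τ A B) : SpectrumSplits W τ σ B A :=
  ⟨h.normal, by rw [Set.union_comm, h.union_eq], h.disjoint.symm, h.subset_right, h.subset_left⟩

lemma SpectrumSplits.isClosed_left (h : SpectrumSplits W σ τ A B) (hA : IsClosed A)
    (hAB : Disjoint A B) : IsClosed σ := by
  have e : σ = spectrum ℂ W ∩ A := by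
    ext x
    rw [← h.union_eq]
    constructor
    · exact fun hx => ⟨Or.inl hx, h.subset_left hx⟩
    · rintro ⟨hx | hx, hxA⟩
      · exact hx
      · exact absurd (h.subset_right hx) (Set.disjoint_left.1 hAB hxA)
  rw [e]
  exact (spectrum.isClosed W).inter hA

lemma SpectrumSplits.continuousOn (h : SpectrumSplits W σ τ A B) (hA : IsClosed A)
    (hB : IsClosed B) (hAB : Disjoint A B) {f g : ℂ → ℂ} (hf : ContinuousOn f σ)
    (hg : ContinuousOn g τ) {k : ℂ → ℂ} (hkf : Set.EqOn k f σ) (hkg : Set.EqOn k g τ) :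
    ContinuousOn k (spectrum ℂ W) := by
  rw [← h.union_eq]
  exact (hf.congr hkf).union_of_isClosed (hg.congr hkg) (h.isClosed_left hA hAB)
    (h.symm.isClosed_left hB hAB.symm)

lemma SpectrumSplits.continuousOn_indicator (h : SpectrumSplits W σ τ A B) (hA : IsClosed A)
    (hB : IsClosed B) (hAB : Disjoint A B) :
    ContinuousOn (σ.indicator fun _ => (1 : ℂ)) (spectrum ℂ W) :=
  h.continuousOn hA hB hAB continuousOn_const continuousOn_const
    (fun _ hx => Set.indicator_of_mem hx _)
    (fun _ hx => Set.indicator_of_notMem (Set.disjoint_right.1 h.disjoint hx) _)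

lemma SpectrumSplits.spectralProj_symm (h : SpectrumSplits W σ τ A B) (hA : IsClosed A)
    (hB : IsClosed B) (hAB : Disjoint A B) : spectralProj W τ = 1 - spectralProj W σ := by
  have := h.normal
  rw [spectralProj, spectralProj, ← cfc_const_one ℂ W, ← cfc_sub _ _ W continuousOn_const
    (h.continuousOn_indicator hA hB hAB)]
  refine cfc_congr fun x hx => ?_
  rw [← h.union_eq] at hx
  rcases hx with hx | hx
  · simp [hx, Set.disjoint_left.1 h.disjoint hx]
  · simp [hx, Set.disjoint_right.1 h.disjoint hx]

/-- The inverse on the complement is the functional calculus of `(w - z)⁻¹` cut off to `τ`; the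
cut-off is continuous because `σ` and `τ` are both closed. Norm bounds are suprema over the
spectrum. -/
lemma SpectrumSplits.discSeparated (h : SpectrumSplits W σ τ A B) (hA : IsClosed A)
    (hB : IsClosed B) (hAB : Disjoint A B) {z : ℂ} {r ρ : ℝ} (hr : 0 ≤ r) (hρ : 0 < ρ)
    (hzA : ∀ w ∈ A, ‖w - z‖ ≤ r) (hzB : ∀ w ∈ B, ρ ≤ ‖w - z‖) :
    DiscSeparated W (spectralProj W σ) z r ρ := by
  have := h.normal
  have ci := h.continuousOn_indicator hA hB hAB
  have ci' := h.symm.continuousOn_indicator hB hA hAB.symm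
  have eQ := h.spectralProj_symm hA hB hAB
  have hM : W - algebraMap ℂ (H →L[ℂ] H) z = cfc (fun w => w - z) W := by
    rw [cfc_sub _ _ W, cfc_id' ℂ W, cfc_const z W]
  have cM : ContinuousOn (fun w : ℂ => w - z) (spectrum ℂ W) := by fun_prop
  have hne : ∀ w ∈ τ, w - z ≠ 0 := fun w hw h0 => by
    have := hzB w (h.subset_right hw)
    rw [h0, norm_zero] at this
    linarith
  have cG : ContinuousOn (τ.indicator fun w => (w - z)⁻¹) (spectrum ℂ W) :=
    h.continuousOn hA hB hAB (f := fun _ => 0) (g := fun w => (w - z)⁻¹) continuousOn_const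
      (ContinuousOn.inv₀ (by fun_prop) hne)
      (fun _ hx => Set.indicator_of_notMem (Set.disjoint_left.1 h.disjoint hx) _)
      (fun _ hx => Set.indicator_of_mem hx _)
  refine ⟨⟨?_, ?_⟩, ?_, ?_, cfc (τ.indicator fun w => (w - z)⁻¹) W, ?_, ?_, ?_, ?_, ?_⟩
  · rw [IsIdempotentElem, spectralProj, ← cfc_mul _ _ W ci ci]
    refine cfc_congr fun x _ => ?_
    by_cases hx : x ∈ σ <;> simp [hx]
  · rw [IsSelfAdjoint, spectralProj, ← cfc_star]
    refine cfc_congr fun x _ => ?_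
    by_cases hx : x ∈ σ <;> simp [hx]
  · have := cfc_commute_cfc (R := ℂ) (fun w => w) (σ.indicator fun _ => (1 : ℂ)) W
    rwa [cfc_id' ℂ W] at this
  · rw [hM, spectralProj, ← cfc_mul _ _ W cM ci]
    refine norm_cfc_le hr fun x _ => ?_
    by_cases hx : x ∈ σ
    · simpa [hx] using hzA x (h.subset_left hx)
    · simpa [hx] using hr
  · rw [← eQ, hM, spectralProj, ← cfc_mul _ _ W cM cG]
    refine cfc_congr fun x _ => ?_
    by_cases hx : x ∈ τ
    · simp [hx, hne x hx]
    · simp [hx]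
  · rw [← eQ, hM, spectralProj, ← cfc_mul _ _ W cG cM]
    refine cfc_congr fun x _ => ?_
    by_cases hx : x ∈ τ
    · simp [hx, hne x hx]
    · simp [hx]
  · rw [← eQ, spectralProj, ← cfc_mul _ _ W cG ci']
    refine cfc_congr fun x _ => ?_
    by_cases hx : x ∈ τ <;> simp [hx]
  · rw [← eQ, spectralProj, ← cfc_mul _ _ W ci' cG]
    refine cfc_congr fun x _ => ?_
    by_cases hx : x ∈ τ <;> simp [hx]
  · have : ‖cfc (τ.indicator fun w => (w - z)⁻¹) W‖ ≤ ρ⁻¹ := by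
      refine norm_cfc_le (by positivity) fun x _ => ?_
      by_cases hx : x ∈ τ
      · simp only [hx, Set.indicator_of_mem, norm_inv]
        exact inv_anti₀ hρ (hzB x (h.subset_right hx))
      · simpa [hx] using hρ.le
    calc ρ * _ ≤ ρ * ρ⁻¹ := by gcongr
      _ = 1 := mul_inv_cancel₀ hρ.ne'

lemma SpectrumSplits.isStarProjection (h : SpectrumSplits W σ τ A B) (hA : IsArc A) (hB : IsArc B)
    (hAB : Disjoint A B) :
    IsStarProjection (spectralProj W σ) ∧ Commute W (spectralProj W σ) := by
  have cA := hA.isCompact.isClosed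
  have cB := hB.isCompact.isClosed
  have hΔ := angularDist_pos hA hB hAB
  obtain ⟨z, r, ρ, hr, hrρ, ⟨h1, h2⟩ | ⟨h1, h2⟩⟩ := hA.exists_disc hB hAB
  · have hs := h.discSeparated cA cB hAB hr (by linarith) h1 h2
    exact ⟨hs.proj, hs.comm⟩
  · have hs := h.symm.discSeparated cB cA hAB.symm hr (by linarith) h1 h2
    rw [h.symm.spectralProj_symm cB cA hAB.symm]
    exact ⟨hs.proj.one_sub, (Commute.one_right _).sub_right hs.comm⟩

/-- One circle serves both operators. If it encloses `B` instead of `A`, exchange the projections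
with their complements, which leaves off-diagonal parts unchanged. -/
lemma SpectrumSplits.sylvester {W' : H →L[ℂ] H} {σ' τ' : Set ℂ} (h : SpectrumSplits W σ τ A B)
    (h' : SpectrumSplits W' σ' τ' A B) (hA : IsArc A) (hB : IsArc B) (hAB : Disjoint A B) :
    SylvesterBound W' (spectralProj W' σ') W (spectralProj W σ) (angularDist A B / 2) ∧
      SylvesterSolvable W (spectralProj W σ) := by
  have cA := hA.isCompact.isClosed
  have cB := hB.isCompact.isClosed
  have hΔ := angularDist_pos hA hB hAB
  obtain ⟨z, r, ρ, hr, hrρ, ⟨h1, h2⟩ | ⟨h1, h2⟩⟩ := hA.exists_disc hB hAB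
  · have hs := h.discSeparated cA cB hAB hr (by linarith) h1 h2
    have hs' := h'.discSeparated cA cB hAB hr (by linarith) h1 h2
    exact ⟨(hs'.sylvesterBound hs hr (by linarith)).mono (by linarith),
      hs.sylvesterSolvable hr (by linarith)⟩
  · have hs := h.symm.discSeparated cB cA hAB.symm hr (by linarith) h1 h2
    have hs' := h'.symm.discSeparated cB cA hAB.symm hr (by linarith) h1 h2
    have hb := (hs'.sylvesterBound hs hr (by linarith)).mono (δ' := angularDist A B / 2)
      (by linarith)
    have hv := hs.sylvesterSolvable hr (by linarith)
    rw [h.spectralProj_symm cA cB hAB] at hb hv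
    rw [h'.spectralProj_symm cA cB hAB] at hb
    constructor
    · intro X
      have := hb X
      rwa [offDiag_one_sub] at this
    · intro Y
      have := hv Y
      simpa only [offDiag_one_sub] using this

end Spectral

/-! ### Summation by parts along the evolution. -/

section Evolution

variable {H : Type*} [NormedAddCommGroup H] [InnerProductSpace ℂ H] [CompleteSpace H]

lemma evolution_mem_unitary {W : ℕ → H →L[ℂ] H} {N : ℕ}
    (hW : ∀ n < N, W n ∈ unitary (H →L[ℂ] H)) :
    ∀ n ≤ N, evolution W n ∈ unitary (H →L[ℂ] H)
  | 0, _ => one_mem _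
  | n + 1, hn => mul_mem (hW n hn) (evolution_mem_unitary hW n (Nat.le_of_succ_le hn))

lemma norm_sub_eq_norm_star_mul_sub_one {U V : H →L[ℂ] H} (hV : V ∈ unitary (H →L[ℂ] H)) :
    ‖U - V‖ = ‖star V * U - 1‖ := by
  rw [← CStarRing.norm_mem_unitary_mul (U - V) (Unitary.star_mem hV), mul_sub,
    Unitary.star_mul_self_of_mem hV]

/-- Summation by parts for the difference of the evolutions generated by `W n` and `V n * W n`. -/
lemma norm_evolution_sub_boundary_le {W V X O : ℕ → H →L[ℂ] H} {N : ℕ}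
    (hW : ∀ n < N, W n ∈ unitary (H →L[ℂ] H)) (hV : ∀ n < N, V n ∈ unitary (H →L[ℂ] H))
    (hX : ∀ n < N, X n * W n - W n * X n = O n * W n) :
    ∀ M < N, ‖star (evolution (fun n => V n * W n) (M + 1)) * evolution W (M + 1) - 1
        - star (evolution (fun n => V n * W n) (M + 1)) * X M * evolution W (M + 1) + X 0‖ ≤
      ∑ n ∈ Finset.range M, ‖X (n + 1) - X n‖ + ∑ n ∈ Finset.range (M + 1),
        (‖star (V n) - 1 - O n‖ + ‖star (V n) - 1‖ * ‖X n‖) := by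
  set U := evolution W with hU
  set Y := evolution fun n => V n * W n with hY
  have uU : ∀ n ≤ N, U n ∈ unitary (H →L[ℂ] H) := evolution_mem_unitary hW
  have uY : ∀ n ≤ N, Y n ∈ unitary (H →L[ℂ] H) :=
    evolution_mem_unitary fun n hn => mul_mem (hV n hn) (hW n hn)
  -- Subtracting `Y† X n U` from `Y† U` absorbs `O n`: the corrector equation gives `W†OW = W†XW -
  -- X`.
  have hstep : ∀ n < N, star (Y (n + 1)) * U (n + 1) - star (Y (n + 1)) * X n * U (n + 1) =
      star (Y n) * U n - star (Y n) * X n * U n + star (Y n) * (star (W n) *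
        ((star (V n) - 1 - O n) - (star (V n) - 1) * X n) * W n) * U n := by
    intro n hn
    have e1 : U (n + 1) = W n * U n := rfl
    have e2 : Y (n + 1) = V n * W n * Y n := rfl
    have e3 : star (W n) * (O n * W n) = star (W n) * X n * W n - X n := by
      rw [← hX n hn, mul_sub, ← mul_assoc, ← mul_assoc (star (W n)),
        Unitary.star_mul_self_of_mem (hW n hn), one_mul]
    have e4 := Unitary.star_mul_self_of_mem (hW n hn)
    have e5 : star (W n) * ((star (V n) - 1 - O n) - (star (V n) - 1) * X n) * W n =
        star (W n) * star (V n) * W n - star (W n) * W n - star (W n) * (O n * W n)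
          - star (W n) * star (V n) * X n * W n + star (W n) * X n * W n := by
      noncomm_ring
    rw [e5, e4, e3, e1, e2, star_mul, star_mul]
    noncomm_ring
  have nerr : ∀ n < N, ‖star (Y n) * (star (W n) *
        ((star (V n) - 1 - O n) - (star (V n) - 1) * X n) * W n) * U n‖ ≤
      ‖star (V n) - 1 - O n‖ + ‖star (V n) - 1‖ * ‖X n‖ := by
    intro n hn
    rw [CStarRing.norm_mul_mem_unitary _ (uU n hn.le),
      CStarRing.norm_mem_unitary_mul _ (Unitary.star_mem (uY n hn.le)),
      CStarRing.norm_mul_mem_unitary _ (hW n hn),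
      CStarRing.norm_mem_unitary_mul _ (Unitary.star_mem (hW n hn))]
    exact (norm_sub_le _ _).trans (add_le_add le_rfl (norm_mul_le _ _))
  intro M
  induction M with
  | zero =>
    intro h0
    have e := hstep 0 h0
    have n0 := nerr 0 h0
    have eU : U 0 = 1 := rfl
    have eY : Y 0 = 1 := rfl
    have : star (Y (0 + 1)) * U (0 + 1) - 1 - star (Y (0 + 1)) * X 0 * U (0 + 1) + X 0 =
        star (Y 0) * (star (W 0) *
          ((star (V 0) - 1 - O 0) - (star (V 0) - 1) * X 0) * W 0) * U 0 := by
      rw [sub_right_comm, e, eU, eY, star_one]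
      noncomm_ring
    rw [this]
    simpa using n0
  | succ M ih =>
    intro hM
    have ih := ih (by omega)
    have e := hstep (M + 1) hM
    have n0 := nerr (M + 1) hM
    have nX : ‖star (Y (M + 1)) * (X (M + 1) - X M) * U (M + 1)‖ = ‖X (M + 1) - X M‖ := by
      rw [CStarRing.norm_mul_mem_unitary _ (uU _ hM.le),
        CStarRing.norm_mem_unitary_mul _ (Unitary.star_mem (uY _ hM.le))]
    have : star (Y (M + 1 + 1)) * U (M + 1 + 1) - 1
          - star (Y (M + 1 + 1)) * X (M + 1) * U (M + 1 + 1) + X 0 =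
        (star (Y (M + 1)) * U (M + 1) - 1 - star (Y (M + 1)) * X M * U (M + 1) + X 0)
        - star (Y (M + 1)) * (X (M + 1) - X M) * U (M + 1)
        + star (Y (M + 1)) * (star (W (M + 1)) * ((star (V (M + 1)) - 1 - O (M + 1))
          - (star (V (M + 1)) - 1) * X (M + 1)) * W (M + 1)) * U (M + 1) := by
      rw [sub_right_comm, e]
      generalize star (Y (M + 1)) * (star (W (M + 1)) * ((star (V (M + 1)) - 1 - O (M + 1))
          - (star (V (M + 1)) - 1) * X (M + 1)) * W (M + 1)) * U (M + 1) = K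
      noncomm_ring
    rw [this, Finset.sum_range_succ _ (M + 1), Finset.sum_range_succ _ M]
    refine (norm_add_le _ _).trans ?_
    have := norm_sub_le (star (Y (M + 1)) * U (M + 1) - 1 - star (Y (M + 1)) * X M * U (M + 1)
      + X 0) (star (Y (M + 1)) * (X (M + 1) - X M) * U (M + 1))
    rw [nX] at this
    linarith

/-- The last corrector is `X M`, paired with the evolutions at `M + 1`, so no step beyond the final
time is needed. -/
lemma norm_evolution_sub_le {W V X O : ℕ → H →L[ℂ] H} {M : ℕ}
    (hW : ∀ n < M + 1, W n ∈ unitary (H →L[ℂ] H)) (hV : ∀ n < M + 1, V n ∈ unitary (H →L[ℂ] H))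
    (hX : ∀ n < M + 1, X n * W n - W n * X n = O n * W n) :
    ‖evolution W (M + 1) - evolution (fun n => V n * W n) (M + 1)‖ ≤
      ‖X 0‖ + ‖X M‖ + ∑ n ∈ Finset.range M, ‖X (n + 1) - X n‖ + ∑ n ∈ Finset.range (M + 1),
        (‖star (V n) - 1 - O n‖ + ‖star (V n) - 1‖ * ‖X n‖) := by
  have h := norm_evolution_sub_boundary_le hW hV hX M (Nat.lt_succ_self M)
  have uU := evolution_mem_unitary hW (M + 1) le_rfl
  have uY := evolution_mem_unitary (fun n hn => mul_mem (hV n hn) (hW n hn)) (M + 1) le_rfl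
  rw [norm_sub_eq_norm_star_mul_sub_one uY]
  generalize evolution W (M + 1) = U at *
  generalize evolution (fun n => V n * W n) (M + 1) = Y at *
  have nX : ‖star Y * X M * U‖ = ‖X M‖ := by
    rw [CStarRing.norm_mul_mem_unitary _ uU, CStarRing.norm_mem_unitary_mul _ (Unitary.star_mem uY)]
  have e : star Y * U - 1 = (star Y * U - 1 - star Y * X M * U + X 0) + star Y * X M * U - X 0 := by
    abel
  have h1 := norm_sub_le ((star Y * U - 1 - star Y * X M * U + X 0) + star Y * X M * U) (X 0)
  have h2 := norm_add_le (star Y * U - 1 - star Y * X M * U + X 0) (star Y * X M * U)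
  rw [← e] at h1
  linarith

end Evolution

/-! ### Estimates in terms of step size and gap. -/

section StepEstimates

variable {H : Type*} [NormedAddCommGroup H] [InnerProductSpace ℂ H] [CompleteSpace H]

/-- A step of size at most `a` between unitaries whose Sylvester equations have lower bound `δ`,
together with the corrector `X` of the step. -/
structure IsGappedStep (W W' P P' X : H →L[ℂ] H) (a δ : ℝ) : Prop where
  pos : 0 < δ
  two_mul_le : 2 * a ≤ δ
  norm_le : ‖W' - W‖ ≤ a
  unitary : W ∈ unitary (H →L[ℂ] H)
  proj : IsStarProjection P
  proj' : IsStarProjection P'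
  bound : SylvesterBound W' P' W P δ
  bound_self : SylvesterBound W P W P δ
  corrector : IsCorrector W P (offTransfer P' P) X

variable {W W' P P' X : H →L[ℂ] H} {a δ : ℝ}

namespace IsGappedStep

lemma nonneg (h : IsGappedStep W W' P P' X a δ) : 0 ≤ a := (norm_nonneg _).trans h.norm_le

lemma div_le (h : IsGappedStep W W' P P' X a δ) : a / δ ≤ 1 / 2 := by
  rw [div_le_iff₀ h.pos]; linarith [h.two_mul_le]

lemma norm_proj_sub_le (h : IsGappedStep W W' P P' X a δ) : ‖P' - P‖ ≤ a / δ := by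
  rw [le_div_iff₀' h.pos]
  exact (h.bound.norm_proj_sub_le h.proj).trans h.norm_le

lemma norm_proj_sub_add_sq_le (h : IsGappedStep W W' P P' X a δ) :
    ‖P' - P‖ + ‖P' - P‖ ^ 2 ≤ 3 / 2 * (a / δ) := by
  have := h.norm_proj_sub_le
  have := h.div_le
  -- For `0 ≤ x ≤ 1/2`, `x + x² ≤ 3x/2`; this is the origin of every `3 / 2` below.
  nlinarith [norm_nonneg (P' - P)]

lemma norm_offTransfer_le (h : IsGappedStep W W' P P' X a δ) :
    ‖offTransfer P' P‖ ≤ 3 / 2 * (a / δ) :=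
  (DiscreteAdiabatic.norm_offTransfer_le h.proj).trans h.norm_proj_sub_add_sq_le

lemma norm_corrector_le (h : IsGappedStep W W' P P' X a δ) :
    ‖X‖ ≤ 3 / 2 * (a / δ) / δ := by
  rw [le_div_iff₀' h.pos]
  exact (h.corrector.norm_le h.unitary h.bound_self).trans h.norm_offTransfer_le

lemma transferV_mem_unitary (h : IsGappedStep W W' P P' X a δ) :
    transferV P' P ∈ _root_.unitary (H →L[ℂ] H) :=
  DiscreteAdiabatic.transferV_mem_unitary h.proj h.proj'
    (by linarith [h.norm_proj_sub_le, h.div_le])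

lemma norm_remainder_le (h : IsGappedStep W W' P P' X a δ) :
    ‖star (transferV P' P) - 1 - offTransfer P' P‖ + ‖star (transferV P' P) - 1‖ * ‖X‖ ≤
      2 * (a / δ) ^ 2 + 9 / 4 * ((a / δ) ^ 2 / δ) := by
  have hd : ‖P' - P‖ < 1 := by linarith [h.norm_proj_sub_le, h.div_le]
  have h1 := norm_star_transferV_sub_one_sub_le h.proj h.proj' hd
  have h2 := (norm_star_transferV_sub_one_le h.proj h.proj' hd).trans h.norm_proj_sub_add_sq_le
  have h3 : ‖P' - P‖ ^ 2 ≤ (a / δ) ^ 2 := by gcongr; exact h.norm_proj_sub_le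
  have h4 : ‖star (transferV P' P) - 1‖ * ‖X‖ ≤ 3 / 2 * (a / δ) * (3 / 2 * (a / δ) / δ) :=
    mul_le_mul h2 h.norm_corrector_le (norm_nonneg _) (le_trans (norm_nonneg _) h2)
  have e : 3 / 2 * (a / δ) * (3 / 2 * (a / δ) / δ) = 9 / 4 * ((a / δ) ^ 2 / δ) := by ring
  linarith

lemma norm_corrector_sub_le {W'' P'' X' : H →L[ℂ] H} {γ : ℝ} (h : IsGappedStep W W' P P' X a δ)
    (h' : IsGappedStep W' W'' P' P'' X' a δ) (hc : Commute W P) (hc' : Commute W' P')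
    (hc'' : Commute W'' P'') (hγ : ‖(W'' - W') - (W' - W)‖ ≤ γ) :
    ‖X' - X‖ ≤ γ / δ ^ 2 + 14 * ((a / δ) ^ 2 / δ) + 3 / 2 * (a / δ) ^ 2 := by
  have hδ := h.pos
  have hE := h'.bound_self.norm_proj_second_diff_le hδ.le h.proj h'.proj h'.proj' hc hc' hc''
  have hX := h.corrector.norm_step_le hδ.le h'.corrector h.proj h'.proj h'.unitary h'.bound_self
  have hO := norm_offTransfer_sub_le (P := P) (P'' := P'') h'.proj
  have d1 := h.norm_proj_sub_le
  have d2 := h'.norm_proj_sub_le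
  have a1 := h.norm_le
  have a2 := h'.norm_le
  have x1 := h.norm_corrector_le
  have o1 := h.norm_offTransfer_le
  have ha := h.nonneg
  set e := a / δ with he
  have hae : a = δ * e := by rw [he]; field_simp
  have he0 : 0 ≤ e := by positivity
  have q1 : ‖W'' - W'‖ * ‖P'' - P'‖ ≤ a * e := by gcongr
  have q2 : ‖W' - W‖ * ‖P' - P‖ ≤ a * e := by gcongr
  have q3 : ‖P'' - P'‖ ^ 2 ≤ e ^ 2 := by gcongr
  have q4 : ‖P' - P‖ ^ 2 ≤ e ^ 2 := by gcongr
  have q5 : ‖offTransfer P' P‖ * ‖W' - W‖ ≤ 3 / 2 * e * a := by gcongr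
  have q6 : ‖X‖ * ‖W' - W‖ ≤ 3 / 2 * e / δ * a := by gcongr
  have q7 : ‖P' - P‖ * ‖X‖ ≤ e * (3 / 2 * e / δ) := by gcongr
  have q6' : 3 / 2 * e / δ * a = 3 / 2 * e ^ 2 := by rw [hae]; field_simp
  have q7' : δ * (e * (3 / 2 * e / δ)) = 3 / 2 * e ^ 2 := by field_simp
  have q8 : δ * (‖P'' - P'‖ ^ 2 + ‖P' - P‖ ^ 2) ≤ δ * (e ^ 2 + e ^ 2) := by gcongr
  have hE' : ‖(P'' - P') - (P' - P)‖ ≤ γ / δ + 6 * e ^ 2 := by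
    have : δ * ‖(P'' - P') - (P' - P)‖ ≤ γ + 6 * (δ * e ^ 2) := by
      have : a * e = δ * e ^ 2 := by rw [hae]; ring
      linarith
    rw [← le_div_iff₀' hδ] at this
    refine this.trans_eq ?_
    field_simp
  have q9 : δ * (2 * (‖P' - P‖ * ‖X‖)) ≤ 3 * e ^ 2 := by
    have := mul_le_mul_of_nonneg_left q7 hδ.le
    linarith
  -- The 14 is 6 from the second difference of `P`, 2 from the squares in `offTransfer`, 3 from the
  -- commutators of `X` with `W' - W`, and 3 from the diagonal part.
  have hfin : δ * ‖X' - X‖ ≤ γ / δ + 14 * e ^ 2 + 3 / 2 * e * a := by linarith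
  rw [← le_div_iff₀' hδ] at hfin
  refine hfin.trans_eq ?_
  rw [hae]
  field_simp

end IsGappedStep

end StepEstimates

/-! ### Neighbourhood maxima and minima. -/

section Hats

lemma finite_neighbours (n : ℕ) (q : ℕ → Prop) :
    {m : ℕ | (m + 1 = n ∨ m = n ∨ m = n + 1) ∧ q m}.Finite :=
  (Set.finite_Iic (n + 1)).subset fun m hm => by
    have := hm.1
    simp only [Set.mem_Iic]
    omega

lemma le_cHat {T : ℕ} {c : ℕ → ℕ → ℝ} {k n m : ℕ} (h : m + 1 = n ∨ m = n ∨ m = n + 1)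
    (hm : m + k ≤ T) : c k m ≤ cHat T c k n :=
  le_csSup ((finite_neighbours n _).image _).bddAbove ⟨m, ⟨h, hm⟩, rfl⟩

lemma gapCheck_le {T : ℕ} {AP AQ : ℕ → ℕ → Set ℂ} {n m : ℕ} (h : m + 1 = n ∨ m = n ∨ m = n + 1)
    (hm : m ≤ T) : gapCheck T AP AQ n ≤ gap T AP AQ m :=
  csInf_le ((finite_neighbours n _).image _).bddBelow ⟨m, ⟨h, hm⟩, rfl⟩

lemma gapCheck_pos {T : ℕ} {AP AQ : ℕ → ℕ → Set ℂ} (h : ∀ m ≤ T, 0 < gap T AP AQ m) {n : ℕ}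
    (hn : n ≤ T) : 0 < gapCheck T AP AQ n := by
  have hne : (gap T AP AQ '' {m : ℕ | (m + 1 = n ∨ m = n ∨ m = n + 1) ∧ m ≤ T}).Nonempty :=
    ⟨_, n, ⟨Or.inr (Or.inl rfl), hn⟩, rfl⟩
  obtain ⟨m, hm, e⟩ := hne.csInf_mem ((finite_neighbours n _).image _)
  rw [gapCheck, ← e]
  exact h m hm.2

/-- The number of steps after `n` that the arcs defining `gap T AP AQ n` cover. -/
def gapIndex (T n : ℕ) : ℕ :=
  if n + 2 ≤ T then 2 else if n + 1 = T then 1 else 0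

lemma gap_eq (T : ℕ) (AP AQ : ℕ → ℕ → Set ℂ) (n : ℕ) :
    gap T AP AQ n = angularDist (AP (gapIndex T n) n) (AQ (gapIndex T n) n) := by
  unfold gap gapIndex gapK
  split_ifs <;> rfl

lemma gapIndex_le_two (T n : ℕ) : gapIndex T n ≤ 2 := by
  unfold gapIndex
  split_ifs <;> omega

lemma add_gapIndex_le {T n : ℕ} (h : n ≤ T) : n + gapIndex T n ≤ T := by
  unfold gapIndex
  split_ifs <;> omega

lemma le_gapIndex {T n l : ℕ} (h : n + l ≤ T) (hl : l ≤ 2) : l ≤ gapIndex T n := by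
  unfold gapIndex
  split_ifs <;> omega

end Hats

/-! ### Verifying the step hypotheses from the multistep arcs. -/

section Main

variable {H : Type*} [NormedAddCommGroup H] [InnerProductSpace ℂ H] [CompleteSpace H]
  {T : ℕ} {W : ℕ → H →L[ℂ] H} {σP σQ : ℕ → Set ℂ} {AP AQ : ℕ → ℕ → Set ℂ}

lemma AreMultistepArcs.gap_pos (hA : AreMultistepArcs T σP σQ AP AQ) {n : ℕ} (hn : n ≤ T) :
    0 < gap T AP AQ n := by
  rw [gap_eq]
  have h1 := gapIndex_le_two T n
  have h2 := add_gapIndex_le hn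
  exact angularDist_pos (hA.isArc_left _ _ h1 h2) (hA.isArc_right _ _ h1 h2)
    (hA.disjoint _ _ h1 h2)

lemma AreMultistepArcs.spectrumSplits (hA : AreMultistepArcs T σP σQ AP AQ)
    (hW : ∀ n ≤ T, W n ∈ unitary (H →L[ℂ] H))
    (hσ : ∀ n ≤ T, σP n ∪ σQ n = spectrum ℂ (W n) ∧ Disjoint (σP n) (σQ n)) {n l : ℕ}
    (hl : l ≤ 2) (hnl : n + l ≤ T) :
    SpectrumSplits (W (n + l)) (σP (n + l)) (σQ (n + l)) (AP (gapIndex T n) n)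
      (AQ (gapIndex T n) n) := by
  have h1 := gapIndex_le_two T n
  have h2 := add_gapIndex_le (le_of_add_le_left hnl)
  have h3 := le_gapIndex hnl hl
  obtain ⟨hu, hd⟩ := hσ _ hnl
  refine ⟨⟨?_⟩, hu, hd, ?_, ?_⟩
  · rw [Commute, SemiconjBy, Unitary.star_mul_self_of_mem (hW _ hnl),
      Unitary.mul_star_self_of_mem (hW _ hnl)]
  · exact (Set.subset_biUnion_of_mem (u := fun l => σP (n + l)) (Set.mem_Iic.2 h3)).trans
      (hA.subset_left _ _ h1 h2)
  · exact (Set.subset_biUnion_of_mem (u := fun l => σQ (n + l)) (Set.mem_Iic.2 h3)).trans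
      (hA.subset_right _ _ h1 h2)

lemma AreMultistepArcs.isStarProjection (hA : AreMultistepArcs T σP σQ AP AQ)
    (hW : ∀ n ≤ T, W n ∈ unitary (H →L[ℂ] H))
    (hσ : ∀ n ≤ T, σP n ∪ σQ n = spectrum ℂ (W n) ∧ Disjoint (σP n) (σQ n)) {n : ℕ}
    (hn : n ≤ T) :
    IsStarProjection (spectralProj (W n) (σP n)) ∧ Commute (W n) (spectralProj (W n) (σP n)) := by
  have h1 := gapIndex_le_two T n
  have h2 := add_gapIndex_le hn
  exact (hA.spectrumSplits hW hσ (l := 0) (by omega) hn).isStarProjection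
    (hA.isArc_left _ _ h1 h2) (hA.isArc_right _ _ h1 h2) (hA.disjoint _ _ h1 h2)

lemma AreMultistepArcs.sylvester (hA : AreMultistepArcs T σP σQ AP AQ)
    (hW : ∀ n ≤ T, W n ∈ unitary (H →L[ℂ] H))
    (hσ : ∀ n ≤ T, σP n ∪ σQ n = spectrum ℂ (W n) ∧ Disjoint (σP n) (σQ n)) {n l l' : ℕ}
    (hl : l ≤ 2) (hnl : n + l ≤ T) (hl' : l' ≤ 2) (hnl' : n + l' ≤ T) :
    SylvesterBound (W (n + l')) (spectralProj (W (n + l')) (σP (n + l')))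
        (W (n + l)) (spectralProj (W (n + l)) (σP (n + l))) (gap T AP AQ n / 2) ∧
      SylvesterSolvable (W (n + l)) (spectralProj (W (n + l)) (σP (n + l))) := by
  have h1 := gapIndex_le_two T n
  have h2 := add_gapIndex_le (le_of_add_le_left hnl)
  rw [gap_eq]
  exact (hA.spectrumSplits hW hσ hl hnl).sylvester (hA.spectrumSplits hW hσ hl' hnl')
    (hA.isArc_left _ _ h1 h2) (hA.isArc_right _ _ h1 h2) (hA.disjoint _ _ h1 h2)

lemma exists_corrector (hA : AreMultistepArcs T σP σQ AP AQ)
    (hW : ∀ n ≤ T, W n ∈ unitary (H →L[ℂ] H))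
    (hσ : ∀ n ≤ T, σP n ∪ σQ n = spectrum ℂ (W n) ∧ Disjoint (σP n) (σQ n)) :
    ∃ X : ℕ → H →L[ℂ] H, ∀ n < T, IsCorrector (W n) (spectralProj (W n) (σP n))
      (offTransfer (spectralProj (W (n + 1)) (σP (n + 1))) (spectralProj (W n) (σP n))) (X n) := by
  have : ∀ n, ∃ X : H →L[ℂ] H, n < T → IsCorrector (W n) (spectralProj (W n) (σP n))
      (offTransfer (spectralProj (W (n + 1)) (σP (n + 1))) (spectralProj (W n) (σP n))) X := by
    intro n
    by_cases hn : n < T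
    · have h1 := hA.isStarProjection hW hσ hn.le
      have h2 := hA.isStarProjection hW hσ (n := n + 1) hn
      obtain ⟨X, hX⟩ := (hA.sylvester hW hσ (n := n) (l := 0) (l' := 0) (by omega) hn.le (by omega)
        hn.le).2.exists_isCorrector h1.1 h2.1 h1.2
      exact ⟨X, fun _ => hX⟩
    · exact ⟨0, fun h => absurd h hn⟩
  choose X hX using this
  exact ⟨X, hX⟩

/-- The step from `n + l` to `n + l + 1` is controlled by any time `m` near `n` and near
`n + l`. -/
lemma isGappedStep (hA : AreMultistepArcs T σP σQ AP AQ)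
    (hW : ∀ n ≤ T, W n ∈ unitary (H →L[ℂ] H))
    (hσ : ∀ n ≤ T, σP n ∪ σQ n = spectrum ℂ (W n) ∧ Disjoint (σP n) (σQ n))
    {c : ℕ → ℕ → ℝ} (hc : ∀ n, n + 1 ≤ T → ‖W (n + 1) - W n‖ ≤ c 1 n / T)
    (hcT : ∀ n ≤ T, 4 * cHat T c 1 n / gapCheck T AP AQ n ≤ (T : ℝ)) {X : ℕ → H →L[ℂ] H}
    (hX : ∀ n < T, IsCorrector (W n) (spectralProj (W n) (σP n))
      (offTransfer (spectralProj (W (n + 1)) (σP (n + 1))) (spectralProj (W n) (σP n))) (X n))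
    {n l m : ℕ} (hl : l ≤ 1) (hn : n + l < T) (hm : m ≤ T)
    (hmn : n + 1 = m ∨ n = m ∨ n = m + 1)
    (hml : n + l + 1 = m ∨ n + l = m ∨ n + l = m + 1) :
    IsGappedStep (W (n + l)) (W (n + l + 1)) (spectralProj (W (n + l)) (σP (n + l)))
      (spectralProj (W (n + l + 1)) (σP (n + l + 1))) (X (n + l))
      (cHat T c 1 m / T) (gapCheck T AP AQ m / 2) := by
  have hT : (0 : ℝ) < T := by exact_mod_cast (by omega : 0 < T)
  have hpos : 0 < gapCheck T AP AQ m := gapCheck_pos (fun m hm => hA.gap_pos hm) hm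
  have hle : gapCheck T AP AQ m / 2 ≤ gap T AP AQ n / 2 := by
    have := gapCheck_le (AP := AP) (AQ := AQ) hmn (by omega : n ≤ T)
    linarith
  refine ⟨by linarith, ?_, ?_, hW _ hn.le, (hA.isStarProjection hW hσ hn.le).1,
    (hA.isStarProjection hW hσ hn).1, ?_, ?_, hX _ hn⟩
  -- With `δ` half the gap, `T ≥ 4ĉ₁/Δ̌` says exactly `2a ≤ δ`.
  · have h := hcT m hm
    rw [div_le_iff₀ hpos] at h
    have : cHat T c 1 m / T ≤ gapCheck T AP AQ m / 4 := by
      rw [div_le_iff₀ hT]; linarith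
    linarith
  · refine (hc _ hn).trans ?_
    gcongr
    exact le_cHat hml hn
  · exact (hA.sylvester hW hσ (n := n) (l := l) (l' := l + 1) (by omega) hn.le (by omega)
      hn).1.mono hle
  · exact (hA.sylvester hW hσ (n := n) (l := l) (l' := l) (by omega) hn.le (by omega)
      hn.le).1.mono hle

end Main

end DiscreteAdiabatic

end

/-! ### Assembly of the final bound. -/

theorem theorem3 {H : Type*} [NormedAddCommGroup H] [InnerProductSpace ℂ H] [CompleteSpace H]
    (T : ℕ) (hT : 0 < T)
    -- the walk operators `W_T(n / T)`, `n = 0, …, T`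
    (W : ℕ → H →L[ℂ] H) (hW : ∀ n ≤ T, W n ∈ unitary (H →L[ℂ] H))
    -- the spectrum of interest, the complementary spectrum, and the arcs around them
    (σP σQ : ℕ → Set ℂ)
    (hσ : ∀ n ≤ T, σP n ∪ σQ n = spectrum ℂ (W n) ∧ Disjoint (σP n) (σQ n))
    (AP AQ : ℕ → ℕ → Set ℂ) (hA : DiscreteAdiabatic.AreMultistepArcs T σP σQ AP AQ)
    -- the bounds on the first and second differences
    (c : ℕ → ℕ → ℝ)
    (hc : ∀ k n, k = 1 ∨ k = 2 → n + k ≤ T → ‖(fwdDiff 1)^[k] W n‖ ≤ c k n / (T : ℝ) ^ k)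
    -- the lower bound on the number of steps
    (hcT : ∀ n ≤ T, 4 * DiscreteAdiabatic.cHat T c 1 n / DiscreteAdiabatic.gapCheck T AP AQ n
      ≤ (T : ℝ))
    -- the time `s = N / T`
    (N : ℕ) (hN : N ≤ T) :
    ‖DiscreteAdiabatic.evolution W N - DiscreteAdiabatic.adiabaticEvolution W σP N‖ ≤
      12 * DiscreteAdiabatic.cHat T c 1 0 / (T * DiscreteAdiabatic.gapCheck T AP AQ 0 ^ 2)
      + 12 * DiscreteAdiabatic.cHat T c 1 N / (T * DiscreteAdiabatic.gapCheck T AP AQ N ^ 2)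
      + 6 * DiscreteAdiabatic.cHat T c 1 N / (T * DiscreteAdiabatic.gapCheck T AP AQ N)
      + 305 * ∑ n ∈ Finset.Ico 1 N, DiscreteAdiabatic.cHat T c 1 n ^ 2
          / ((T : ℝ) ^ 2 * DiscreteAdiabatic.gapCheck T AP AQ n ^ 3)
      + 44 * ∑ n ∈ Finset.range N, DiscreteAdiabatic.cHat T c 1 n ^ 2
          / ((T : ℝ) ^ 2 * DiscreteAdiabatic.gapCheck T AP AQ n ^ 2)
      + 32 * ∑ n ∈ Finset.Ico 1 N, DiscreteAdiabatic.cHat T c 2 n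
          / ((T : ℝ) ^ 2 * DiscreteAdiabatic.gapCheck T AP AQ n ^ 2) := by
  open DiscreteAdiabatic in
  have hT' : (0 : ℝ) < T := by exact_mod_cast hT
  have hc1 : ∀ n, n + 1 ≤ T → ‖W (n + 1) - W n‖ ≤ c 1 n / T := fun n hn => by
    simpa [fwdDiff] using hc 1 n (Or.inl rfl) hn
  have hc2 : ∀ n, n + 2 ≤ T → ‖(W (n + 2) - W (n + 1)) - (W (n + 1) - W n)‖ ≤ c 2 n / T ^ 2 :=
    fun n hn => by simpa [fwdDiff, add_assoc] using hc 2 n (Or.inr rfl) hn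
  have hpos : ∀ n ≤ T, 0 < gapCheck T AP AQ n := fun n hn =>
    gapCheck_pos (fun m hm => hA.gap_pos hm) hn
  have hc1n : ∀ n ≤ T, 0 ≤ cHat T c 1 n := by
    have key : ∀ m, m + 1 ≤ T → 0 ≤ c 1 m := fun m hm => by
      have := (norm_nonneg _).trans (hc1 m hm)
      rwa [le_div_iff₀ hT', zero_mul] at this
    intro n hn
    rcases Nat.lt_or_ge n T with h | h
    · exact (key n h).trans (le_cHat (by omega) h)
    -- At the last time only the neighbour `T - 1` has a first difference.
    · exact (key (n - 1) (by omega)).trans (le_cHat (by omega) (by omega))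
  have hc2n : ∀ n, 1 ≤ n → n < T → 0 ≤ cHat T c 2 n := by
    intro n h1 h2
    have h := (norm_nonneg _).trans (hc2 (n - 1) (by omega))
    rw [le_div_iff₀ (by positivity), zero_mul] at h
    exact h.trans (le_cHat (by omega) (by omega))
  have t1 : ∀ n ∈ Finset.Ico 1 N, 0 ≤ cHat T c 1 n ^ 2 / ((T : ℝ) ^ 2 * gapCheck T AP AQ n ^ 3) :=
    fun n hn => by
      have := hpos n (by rw [Finset.mem_Ico] at hn; omega)
      positivity
  have t2 : ∀ n ∈ Finset.range N, 0 ≤ cHat T c 1 n ^ 2 / ((T : ℝ) ^ 2 * gapCheck T AP AQ n ^ 2) :=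
    fun n hn => by
      have := hpos n (by rw [Finset.mem_range] at hn; omega)
      positivity
  have t3 : ∀ n ∈ Finset.Ico 1 N, 0 ≤ cHat T c 2 n / ((T : ℝ) ^ 2 * gapCheck T AP AQ n ^ 2) :=
    fun n hn => by
      rw [Finset.mem_Ico] at hn
      have := hpos n (by omega)
      have := hc2n n hn.1 (by omega)
      positivity
  have b0 : 0 ≤ cHat T c 1 0 / (T * gapCheck T AP AQ 0 ^ 2) :=
    div_nonneg (hc1n 0 hT.le) (by positivity)
  have bN : 0 ≤ cHat T c 1 N / (T * gapCheck T AP AQ N ^ 2) :=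
    div_nonneg (hc1n N hN) (by positivity)
  have bN' : 0 ≤ cHat T c 1 N / (T * gapCheck T AP AQ N) :=
    div_nonneg (hc1n N hN) (mul_nonneg hT'.le (hpos N hN).le)
  simp only [mul_div_assoc]
  cases N with
  | zero =>
    have : evolution W 0 - adiabaticEvolution W σP 0 = 0 := sub_self 1
    rw [this, norm_zero]
    simp only [Finset.range_zero, Finset.sum_empty, mul_zero, add_zero, Finset.Ico_eq_empty_of_le,
      zero_le_one]
    linarith
  | succ M =>
    obtain ⟨X, hX⟩ := exists_corrector hA hW hσ
    have hs : ∀ n < T, IsGappedStep (W n) (W (n + 1)) (spectralProj (W n) (σP n))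
        (spectralProj (W (n + 1)) (σP (n + 1))) (X n) (cHat T c 1 n / T) (gapCheck T AP AQ n / 2) :=
      fun n hn => isGappedStep hA hW hσ hc1 hcT hX (l := 0) zero_le_one hn hn.le (by omega)
        (by omega)
    -- The step from `n` is also measured at `n + 1`, so that increments of `X` and the final
    -- corrector carry the constants of the later time.
    have hs1 : ∀ n < T, IsGappedStep (W n) (W (n + 1)) (spectralProj (W n) (σP n))
        (spectralProj (W (n + 1)) (σP (n + 1))) (X n) (cHat T c 1 (n + 1) / T)
        (gapCheck T AP AQ (n + 1) / 2) :=
      fun n hn => isGappedStep hA hW hσ hc1 hcT hX (l := 0) zero_le_one hn hn (by omega)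
        (by omega)
    have hs2 : ∀ n, n + 1 < T → IsGappedStep (W (n + 1)) (W (n + 2))
        (spectralProj (W (n + 1)) (σP (n + 1))) (spectralProj (W (n + 2)) (σP (n + 2))) (X (n + 1))
        (cHat T c 1 (n + 1) / T) (gapCheck T AP AQ (n + 1) / 2) :=
      fun n hn => isGappedStep hA hW hσ hc1 hcT hX (l := 1) le_rfl hn hn.le (by omega)
        (by omega)
    have main := norm_evolution_sub_le (M := M) (W := W) (X := X)
      (V := fun n => transferV (spectralProj (W (n + 1)) (σP (n + 1))) (spectralProj (W n) (σP n)))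
      (O := fun n => offTransfer (spectralProj (W (n + 1)) (σP (n + 1)))
        (spectralProj (W n) (σP n)))
      (fun n hn => hW n (by omega)) (fun n hn => (hs n (by omega)).transferV_mem_unitary)
      (fun n hn => (hX n (by omega)).eq)
    have hdiff : ∀ n ∈ Finset.range M, ‖X (n + 1) - X n‖ ≤
        4 * (cHat T c 2 (1 + n) / ((T : ℝ) ^ 2 * gapCheck T AP AQ (1 + n) ^ 2))
        + 112 * (cHat T c 1 (1 + n) ^ 2 / ((T : ℝ) ^ 2 * gapCheck T AP AQ (1 + n) ^ 3))
        + 6 * (cHat T c 1 (1 + n) ^ 2 / ((T : ℝ) ^ 2 * gapCheck T AP AQ (1 + n) ^ 2)) := by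
      intro n hn
      rw [Finset.mem_range] at hn
      have h2 : ‖(W (n + 2) - W (n + 1)) - (W (n + 1) - W n)‖ ≤ cHat T c 2 (n + 1) / T ^ 2 := by
        refine (hc2 n (by omega)).trans ?_
        gcongr
        exact le_cHat (by omega) (by omega)
      have h := (hs1 n (by omega)).norm_corrector_sub_le (hs2 n (by omega))
        (hA.isStarProjection hW hσ (by omega)).2 (hA.isStarProjection hW hσ (by omega)).2
        (hA.isStarProjection hW hσ (by omega)).2 h2
      have hp := hpos (n + 1) (by omega)
      rw [add_comm 1 n]
      refine h.trans_eq ?_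
      field_simp
      ring
    have hrem : ∀ n ∈ Finset.range (M + 1),
        ‖star (transferV (spectralProj (W (n + 1)) (σP (n + 1))) (spectralProj (W n) (σP n))) - 1
          - offTransfer (spectralProj (W (n + 1)) (σP (n + 1))) (spectralProj (W n) (σP n))‖
        + ‖star (transferV (spectralProj (W (n + 1)) (σP (n + 1))) (spectralProj (W n) (σP n))) - 1‖
          * ‖X n‖ ≤ 8 * (cHat T c 1 n ^ 2 / ((T : ℝ) ^ 2 * gapCheck T AP AQ n ^ 2))
          + 18 * (cHat T c 1 n ^ 2 / ((T : ℝ) ^ 2 * gapCheck T AP AQ n ^ 3)) := by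
      intro n hn
      rw [Finset.mem_range] at hn
      have hp := hpos n (by omega)
      refine (hs n (by omega)).norm_remainder_le.trans_eq ?_
      field_simp
      ring
    have hX0 : ‖X 0‖ ≤ 6 * (cHat T c 1 0 / (T * gapCheck T AP AQ 0 ^ 2)) := by
      have hp := hpos 0 hT.le
      refine (hs 0 hT).norm_corrector_le.trans_eq ?_
      field_simp
      ring
    have hXM : ‖X M‖ ≤ 6 * (cHat T c 1 (M + 1) / (T * gapCheck T AP AQ (M + 1) ^ 2)) := by
      have hp := hpos (M + 1) hN
      refine (hs1 M hN).norm_corrector_le.trans_eq ?_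
      field_simp
      ring
    -- The cubic sum in the statement starts at 1, so its term at 0 is absorbed into the boundary
    -- term through `T ≥ 4ĉ₁/Δ̌`.
    have h0 : cHat T c 1 0 ^ 2 / ((T : ℝ) ^ 2 * gapCheck T AP AQ 0 ^ 3) ≤
        1 / 4 * (cHat T c 1 0 / (T * gapCheck T AP AQ 0 ^ 2)) := by
      have hp := hpos 0 hT.le
      have h := hcT 0 hT.le
      rw [div_le_iff₀ hp] at h
      have e : cHat T c 1 0 ^ 2 / ((T : ℝ) ^ 2 * gapCheck T AP AQ 0 ^ 3) =
          cHat T c 1 0 / (T * gapCheck T AP AQ 0)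
            * (cHat T c 1 0 / (T * gapCheck T AP AQ 0 ^ 2)) := by
        field_simp
      rw [e]
      refine mul_le_mul_of_nonneg_right ?_ b0
      rw [div_le_iff₀ (by positivity)]
      linarith
    have s1 := Finset.sum_le_sum hdiff
    have s2 := Finset.sum_le_sum hrem
    simp only [Finset.sum_add_distrib, ← Finset.mul_sum] at s1
    rw [Finset.sum_add_distrib (f := fun n => 8 * _), ← Finset.mul_sum, ← Finset.mul_sum] at s2
    have ico : ∀ f : ℕ → ℝ, ∑ n ∈ Finset.range M, f (1 + n) = ∑ n ∈ Finset.Ico 1 (M + 1), f n :=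
      fun f => by rw [Finset.sum_Ico_eq_sum_range, Nat.add_sub_cancel]
    have rng : ∀ f : ℕ → ℝ, ∑ n ∈ Finset.range (M + 1), f n =
        f 0 + ∑ n ∈ Finset.Ico 1 (M + 1), f n := fun f => by
      rw [← ico, Finset.sum_range_succ', add_comm]
      simp only [add_comm]
    rw [ico fun n => cHat T c 2 n / ((T : ℝ) ^ 2 * gapCheck T AP AQ n ^ 2),
      ico fun n => cHat T c 1 n ^ 2 / ((T : ℝ) ^ 2 * gapCheck T AP AQ n ^ 3),
      ico fun n => cHat T c 1 n ^ 2 / ((T : ℝ) ^ 2 * gapCheck T AP AQ n ^ 2)] at s1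
    rw [rng fun n => cHat T c 1 n ^ 2 / ((T : ℝ) ^ 2 * gapCheck T AP AQ n ^ 3)] at s2
    have r2 := rng fun n => cHat T c 1 n ^ 2 / ((T : ℝ) ^ 2 * gapCheck T AP AQ n ^ 2)
    have u1 := Finset.sum_nonneg t1
    have u2 := Finset.sum_nonneg t2
    have u3 := Finset.sum_nonneg t3
    have u4 := t2 0 (by simp)
    have goal := main.trans (add_le_add (add_le_add (add_le_add hX0 hXM) s1) s2)
    refine (show ‖evolution W (M + 1) - adiabaticEvolution W σP (M + 1)‖ ≤ _ from goal).trans ?_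
    -- The estimates give coefficients 6 + 18/4 and 6 for the boundary, 112 + 18 for the cubic sum,
    -- at most 6 + 8 for the quadratic one and 4 for the second differences, all below those
    -- claimed.
    linarith
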